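/- Setting. All functions are real valued and defined on $\mathbb{R}^3$. For $A\subseteq\mathbb{R}^3$ let $\mathrm{cap}(A)=\inf\{\|w\|_{H^1(\mathbb{R}^3)}^2 : w\in H^1(\mathbb{R}^3),\ w\ge 1 \text{ a.e. in an open neighbourhood of } A\}$ be the Sobolev capacity; "quasi-everywhere" means up to a set of zero capacity. A measurable set $\Omega\subseteq\mathbb{R}^3$ is quasi-open if for every $\varepsilon>0$ there is an open set $G$ with $\mathrm{cap}(G)<\varepsilon$ and $\Omega\cup G$ open. A function is quasi-continuous if for every $\varepsilon>0$ it is continuous on the complement of some open set of capacity less than $\varepsilon$. Let $H^1_0(\Omega)$ be the set of $u\in H^1(\mathbb{R}^3)$ whose quasi-continuous representative vanishes quasi-everywhere in $\mathbb{R}^3\setminus\Omega$. Put $$D(\phi,\psi)=\int_\Omega\int_\Omega\frac{\phi(x)\psi(y)}{|x-y|}\,dx\,dy,\qquad v_u(x)=\Big(u*\frac1{|\cdot|}\Big)(x)=\int_\Omega\frac{u(y)}{|x-y|}\,dy,$$ $$E_q(u,\Omega)=\int_\Omega|\nabla u|^2\,dx+\frac q2 D(u,u),\qquad E_q(\Omega)=\inf\Big\{E_q(u,\Omega):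 u\in H^1_0(\Omega),\ \int_\Omega u^2\,dx=1\Big\},$$ with $\inf\emptyset=+\infty$. An optimal function of $E_q(\Omega)$ is a $u\in H^1_0(\Omega)$ with $\int_\Omega u^2\,dx=1$ and $E_q(u,\Omega)=E_q(\Omega)$. Let $B_1$ be the open unit ball. Theorem 3.2. There is a function $m\mapsto C(m)$ of one real variable such that the following holds. Let $q\in[0,1)$ and let $\Omega\subseteq\mathbb{R}^3$ be a quasi-open set of finite measure with $E_q(\Omega)\le E_1(B_1)$. Then every optimal function $u_q$ of $E_q(\Omega)$ is a weak solution of $$-\Delta u_q-\lambda_{q,\Omega}u_q=-\frac q2\Big(u_q*\frac1{|\cdot|}\Big)\ \text{ in } H^1_0(\Omega),\qquad \lambda_{q,\Omega}=\int_\Omega|\nabla u_q|^2\,dx+\frac q2D(u_q,u_q),$$ that is, for all $\varphi\in H^1_0(\Omega)$, $$\int_\Omega\nabla u_q\cdot\nabla\varphi\,dx-\lambda_{q,\Omega}\int_\Omega u_q\varphi\,dx=-\frac q2\int_\Omega v_{u_q}\varphi\,dx .$$ Moreover $u_q$ is $C^\infty$ in $\Omega$, in the sense that for every open set $U$ with $\mathrm{cap}(U\setminus\Omega)=0$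 (in particular the interior of $\Omega$, and $\Omega$ itself when it is open) $u_q$ agrees almost everywhere in $U$ with a $C^\infty$ function on $U$. Finally $$\|u_q\|_{L^\infty(\Omega)}\le C(|\Omega|),\qquad \|v_{u_q}\|_{L^\infty(\mathbb{R}^3)}\le C(|\Omega|).$$ -/

import Mathlib

open MeasureTheory Set
open scoped ContDiff ENNReal RealInnerProductSpace

noncomputable section

namespace CoulombShape

/-- Three-dimensional Euclidean space. -/
abbrev E3 : Type := EuclideanSpace ℝ (Fin 3)

/-! ### The Sobolev space of the whole space -/

/-- `g` is the distributional gradient of `u` on the whole space: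
`∫ u ∇φ = - ∫ φ g` for every test function `φ`. -/
def HasWeakGradient (u : E3 → ℝ) (g : E3 → E3) : Prop :=
  LocallyIntegrable u volume ∧ LocallyIntegrable g volume ∧
    ∀ φ : E3 → ℝ, ContDiff ℝ ∞ φ → HasCompactSupport φ →
      ∫ x, u x • gradient φ x = - ∫ x, φ x • g x

/-- `u` belongs to `H¹(ℝ³)`. -/
def MemH1 (u : E3 → ℝ) : Prop :=
  MemLp u 2 volume ∧ ∃ g : E3 → E3, HasWeakGradient u g ∧ MemLp g 2 volume

/-- The weak gradient `∇u` (a representative of it; it is unique up to null sets, and the value is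
only meaningful for functions that have a weak gradient). -/
def weakGrad (u : E3 → ℝ) : E3 → E3 :=
  Classical.epsilon (HasWeakGradient u)

/-! ### Sobolev capacity and quasi-open sets -/

/-- The Sobolev capacity of a set `A`: the infimum of `‖w‖²_{H¹}` over all `w ∈ H¹(ℝ³)` with
`w ≥ 1` almost everywhere in an open neighbourhood of `A`. -/
def capacity (A : Set E3) : ℝ≥0∞ :=
  ⨅ (w : E3 → ℝ) (_ : MemH1 w)
    (_ : ∃ U : Set E3, IsOpen U ∧ A ⊆ U ∧ ∀ᵐ x ∂(volume.restrict U), 1 ≤ w x),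
    ENNReal.ofReal ((∫ x, w x ^ 2) + ∫ x, ‖weakGrad w x‖ ^ 2)

/-- A (Lebesgue) measurable set is quasi-open if it becomes open after the union with an open set
of arbitrarily small capacity. -/
def IsQuasiOpen (Ω : Set E3) : Prop :=
  NullMeasurableSet Ω volume ∧
    ∀ ε : ℝ≥0∞, 0 < ε → ∃ G : Set E3, IsOpen G ∧ capacity G < ε ∧ IsOpen (Ω ∪ G)

/-- A function is quasi-continuous if it is continuous on the complement of an open set of
arbitrarily small capacity. -/
def IsQuasiContinuous (u : E3 → ℝ) : Prop :=
  ∀ ε : ℝ≥0∞, 0 < ε → ∃ G : Set E3, IsOpen G ∧ capacity G < ε ∧ ContinuousOn u Gᶜ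

/-- A set of finite capacity has an open neighbourhood of almost the same capacity. -/
theorem exists_isOpen_capacity_lt {K : Set E3} {ε : ℝ≥0∞} (h : capacity K < ε) :
    ∃ G : Set E3, IsOpen G ∧ K ⊆ G ∧ capacity G < ε := by
  simp only [capacity, iInf_lt_iff] at h
  obtain ⟨w, hw, ⟨U, hU, hKU, hwU⟩, hlt⟩ := h
  refine ⟨U, hU, hKU, lt_of_le_of_lt ?_ hlt⟩
  exact iInf_le_of_le w (iInf_le_of_le hw (iInf_le_of_le ⟨U, hU, Subset.rfl, hwU⟩ le_rfl))

/-- A measurable set which becomes open after the removal of compact sets of arbitrarily small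
capacity is quasi-open. -/
theorem IsQuasiOpen.of_diff_compact {Ω : Set E3} (hm : NullMeasurableSet Ω volume)
    (h : ∀ ε : ℝ≥0∞, 0 < ε → ∃ K : Set E3, IsCompact K ∧ capacity K < ε ∧ IsOpen (Ω \ K)) :
    IsQuasiOpen Ω := by
  refine ⟨hm, fun ε hε => ?_⟩
  obtain ⟨K, -, hK, hΩ⟩ := h ε hε
  obtain ⟨G, hG, hKG, hlt⟩ := exists_isOpen_capacity_lt hK
  refine ⟨G, hG, hlt, ?_⟩
  have : Ω ∪ G = (Ω \ K) ∪ G := by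
    ext x
    by_cases hx : x ∈ K
    · simp [hKG hx]
    · simp [hx]
  rw [this]
  exact hΩ.union hG

/-- `u` belongs to `H¹₀(Ω)`: it is in `H¹(ℝ³)` and its quasi-continuous representative vanishes
quasi-everywhere (that is, up to a set of zero capacity) outside `Ω`. -/
def MemH10 (Ω : Set E3) (u : E3 → ℝ) : Prop :=
  MemH1 u ∧ ∃ v : E3 → ℝ, IsQuasiContinuous v ∧ v =ᵐ[volume] u ∧
    capacity {x | x ∉ Ω ∧ v x ≠ 0} = 0

/-! ### The energy -/

/-- The Dirichlet energy `∫_Ω |∇u|²`. -/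
def dirichlet (Ω : Set E3) (u : E3 → ℝ) : ℝ :=
  ∫ x in Ω, ‖weakGrad u x‖ ^ 2

/-- The Coulomb energy `D(φ, ψ) = ∫_Ω ∫_Ω φ(x) ψ(y) / |x - y| dx dy`. -/
def coulomb (Ω : Set E3) (φ ψ : E3 → ℝ) : ℝ :=
  ∫ x in Ω, ∫ y in Ω, φ x * ψ y / ‖x - y‖

/-- The potential `v_u = u * 1/|·|`, that is `v_u(x) = ∫_Ω u(y) / |x - y| dy`. The integrand is
integrable for every `x` when `u` is square integrable and `Ω` has finite measure. -/
def potential (Ω : Set E3) (u : E3 → ℝ) (x : E3) : ℝ :=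
  ∫ y in Ω, u y / ‖x - y‖

/-- The energy `E_q(u, Ω) = ∫_Ω |∇u|² + (q/2) D(u, u)`. -/
def energy (q : ℝ) (Ω : Set E3) (u : E3 → ℝ) : ℝ :=
  dirichlet Ω u + q / 2 * coulomb Ω u u

/-- The admissible functions: `u ∈ H¹₀(Ω)` with `∫_Ω u² = 1`. -/
def IsAdmissible (Ω : Set E3) (u : E3 → ℝ) : Prop :=
  MemH10 Ω u ∧ ∫ x in Ω, u x ^ 2 = 1

/-- The ground state energy `E_q(Ω)`, the infimum of `E_q(u, Ω)` over admissible `u`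
(`+∞` if there are none). -/
def groundEnergy (q : ℝ) (Ω : Set E3) : EReal :=
  ⨅ (u : E3 → ℝ) (_ : IsAdmissible Ω u), (energy q Ω u : EReal)

/-- `u` is an optimal function for `E_q(Ω)`: it is admissible and attains the infimum. -/
def IsOptimal (q : ℝ) (Ω : Set E3) (u : E3 → ℝ) : Prop :=
  IsAdmissible Ω u ∧ (energy q Ω u : EReal) = groundEnergy q Ω

/-- `u` is a weak solution of `-Δu - lam u = f` in `H¹₀(Ω)`, tested against all of `H¹₀(Ω)`. -/
def IsWeakSolution (Ω : Set E3) (lam : ℝ) (f u : E3 → ℝ) : Prop :=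
  MemH10 Ω u ∧ ∀ φ : E3 → ℝ, MemH10 Ω φ →
    (∫ x in Ω, ⟪weakGrad u x, weakGrad φ x⟫) - lam * (∫ x in Ω, u x * φ x)
      = ∫ x in Ω, f x * φ x

/-- `u` is smooth in the quasi-open set `Ω`: on every open set `U` contained in `Ω` up to a set of
zero capacity (for instance, the interior of `Ω`, and `Ω` itself if it is open), `u` coincides
almost everywhere with a `C^∞` function on `U`. -/
def IsSmoothIn (Ω : Set E3) (u : E3 → ℝ) : Prop :=
  ∀ U : Set E3, IsOpen U → capacity (U \ Ω) = 0 →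
    ∃ w : E3 → ℝ, ContDiffOn ℝ ∞ w U ∧ w =ᵐ[volume.restrict U] u

end CoulombShape

end

open CoulombShape

/-!
An optimal function minimizes the homogeneous quadratic energy on the unit sphere of `L²(Ω)`, so
`E_q(w, Ω) ≥ E_q(Ω) ∫_Ω w²` for every `w ∈ H¹₀(Ω)`. Expanding this at `w = u + t φ` gives a
nonnegative quadratic polynomial in `t` without constant term, whose linear coefficient must vanish:
this is the weak equation (`IsOptimal.isWeakSolution`). It uses that `H¹₀(Ω)` is a linear space,
hence that the union of two sets of small capacity has small capacity; this follows from the chain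
rule for a smooth substitute `softPos` of the positive part, up to a harmless factor
(`capacity_union_le`). The multiplier is at most the energy of a fixed bump function on the unit
ball, by the comparison of the ground state energies.

The potential is bounded pointwise, by `|u| / r ≤ (u² + r⁻²) / 2` and the local integrability of
`r⁻²` in dimension three (`abs_potential_le`). For the bound on `u`, the equation is tested with
`ψ · softSign u`, where `softSign` is the derivative of the smooth convex function
`softAbs t = √(1 + t²) - 1`. This gives `-Δ (softAbs u) ≤ Λ |u| + P` as distributions on all of
`ℝ³`, not only in `Ω` (`IsWeakSolution.integral_softAbs_mul_lap`). Pairing with the truncated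
Newtonian kernel, which is square integrable in dimension three, bounds `softAbs u` in terms of
`Λ`, `P` and the `L²` norm of `u` (`IsWeakSolution.ae_abs_le`).

For the smoothness, the pair of `u` and its potential `v` solves a closed linear system with
constant coefficients on every open set contained in `Ω` up to capacity zero, because `-Δv` is a
multiple of `u`. So all powers `Δᵏ u` are linear combinations of `u` and `v`
(`exists_integral_mul_iterate_lap`). The truncated fundamental solution `η |y|²ᵐ⁺¹` of `Δᵐ⁺²` is of
class `Cᵐ` and inverts it up to a smooth kernel (`exists_parametrix`), so that `u` coincides locally
with a `Cᵐ` function, for every `m` (`exists_contDiff_ae_eq`).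
-/

noncomputable section

namespace CoulombShape

open Filter Topology
open scoped Convolution Pointwise

/-! ### Test functions and partial derivatives -/

/-- The partial derivative `∂ᵢ f`. -/
def pd (i : Fin 3) (f : E3 → ℝ) : E3 → ℝ :=
  fun x => fderiv ℝ f x (EuclideanSpace.single i 1)

/-- The Laplacian, as the sum of the pure second partial derivatives. -/
def lap (f : E3 → ℝ) : E3 → ℝ :=
  fun x => ∑ i, pd i (pd i f) x

/-- Test functions: smooth functions of compact support. -/
structure IsTest (φ : E3 → ℝ) : Prop where
  smooth : ContDiff ℝ ∞ φ
  supp : HasCompactSupport φ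

theorem gradient_apply (f : E3 → ℝ) (x : E3) (i : Fin 3) : gradient f x i = pd i f x := by
  have h : ⟪gradient f x, EuclideanSpace.single i (1 : ℝ)⟫ = pd i f x := by
    rw [gradient, InnerProductSpace.toDual_symm_apply, pd]
  rw [← h, EuclideanSpace.inner_single_right]
  simp

theorem ContDiff.pd {f : E3 → ℝ} (hf : ContDiff ℝ ∞ f) (i : Fin 3) : ContDiff ℝ ∞ (pd i f) :=
  (hf.fderiv_right (m := ∞) (by simp)).clm_apply contDiff_const

theorem ContDiff.lap {f : E3 → ℝ} (hf : ContDiff ℝ ∞ f) : ContDiff ℝ ∞ (lap f) :=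
  ContDiff.sum fun i _ => ContDiff.pd (ContDiff.pd hf i) i

theorem tsupport_pd_subset (f : E3 → ℝ) (i : Fin 3) : tsupport (pd i f) ⊆ tsupport f := by
  refine (closure_mono fun x hx => ?_).trans (tsupport_fderiv_subset ℝ (f := f))
  rw [Function.mem_support] at hx ⊢
  intro h
  exact hx (by simp [pd, h])

theorem tsupport_lap_subset (f : E3 → ℝ) : tsupport (lap f) ⊆ tsupport f := by
  refine closure_minimal (fun x hx => ?_) (isClosed_tsupport f)
  by_contra h
  refine hx (Finset.sum_eq_zero fun i _ => ?_)
  exact image_eq_zero_of_notMem_tsupport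
    fun h' => h (tsupport_pd_subset f i (tsupport_pd_subset _ i h'))

namespace IsTest

variable {φ ψ f : E3 → ℝ}

theorem continuous (h : IsTest φ) : Continuous φ := h.smooth.continuous

theorem differentiable (h : IsTest φ) : Differentiable ℝ φ := h.smooth.differentiable (by simp)

theorem integrable (h : IsTest φ) : Integrable φ :=
  h.continuous.integrable_of_hasCompactSupport h.supp

theorem memLp (h : IsTest φ) (p : ℝ≥0∞) : MemLp φ p :=
  h.continuous.memLp_of_hasCompactSupport h.supp

theorem pd (h : IsTest φ) (i : Fin 3) : IsTest (pd i φ) :=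
  ⟨ContDiff.pd h.smooth i, h.supp.of_isClosed_subset (isClosed_tsupport _) (tsupport_pd_subset φ i)⟩

theorem lap (h : IsTest φ) : IsTest (lap φ) :=
  ⟨ContDiff.lap h.smooth, h.supp.of_isClosed_subset (isClosed_tsupport _) (tsupport_lap_subset φ)⟩

theorem mul_left (h : IsTest φ) (hf : ContDiff ℝ ∞ f) : IsTest (fun x => f x * φ x) :=
  ⟨hf.mul h.smooth, h.supp.mul_left⟩

theorem sub_left (h : IsTest φ) (x : E3) : IsTest (fun y => φ (x - y)) :=
  ⟨h.smooth.comp (contDiff_const.sub contDiff_id),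
    h.supp.comp_homeomorph (Homeomorph.subLeft x)⟩

theorem integrable_mul (h : IsTest φ) (hf : LocallyIntegrable f) :
    Integrable fun x => f x * φ x := by
  simpa [mul_comm] using hf.integrable_smul_left_of_hasCompactSupport h.continuous h.supp

theorem exists_bound (h : IsTest φ) : ∃ C, 0 ≤ C ∧ ∀ x, ‖φ x‖ ≤ C := by
  obtain ⟨C, hC⟩ := h.supp.exists_bound_of_continuous h.continuous
  exact ⟨C, (norm_nonneg _).trans (hC 0), hC⟩

end IsTest

theorem pd_sub_left (f : E3 → ℝ) (i : Fin 3) (x y : E3) :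
    pd i (fun z => f (x - z)) y = - pd i f (x - y) := by
  have h : (fun z => f (x - z)) =
      (fun w => f (x + w)) ∘ (ContinuousLinearEquiv.neg ℝ : E3 ≃L[ℝ] E3) := by
    ext z; simp [sub_eq_add_neg]
  simp only [pd]
  rw [h, ContinuousLinearEquiv.comp_right_fderiv, fderiv_comp_add_left]
  simp [sub_eq_add_neg]

theorem lap_sub_left (f : E3 → ℝ) (x : E3) :
    lap (fun z => f (x - z)) = fun y => lap f (x - y) := by
  ext y
  refine Finset.sum_congr rfl fun i _ => ?_
  have : pd i (fun z => f (x - z)) = fun z => (fun w => - pd i f w) (x - z) := by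
    ext z; exact pd_sub_left f i x z
  rw [this]
  refine (pd_sub_left (fun w => - pd i f w) i x y).trans ?_
  simp only [pd, fderiv_fun_neg, neg_apply, neg_neg]
  rfl

theorem pd_mul {f g : E3 → ℝ} {x : E3} (hf : DifferentiableAt ℝ f x)
    (hg : DifferentiableAt ℝ g x) (i : Fin 3) :
    pd i (fun y => f y * g y) x = f x * pd i g x + pd i f x * g x := by
  simp only [pd]
  rw [fderiv_fun_mul hf hg]
  simp [mul_comm]

theorem integral_mul_pd {f φ : E3 → ℝ} (hf : ContDiff ℝ 1 f) (hφ : IsTest φ) (i : Fin 3) :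
    ∫ x, f x * pd i φ x = - ∫ x, pd i f x * φ x := by
  have hc : Continuous (pd i f) :=
    (hf.continuous_fderiv (by simp)).clm_apply continuous_const
  refine integral_mul_fderiv_eq_neg_fderiv_mul_of_integrable
    (hφ.integrable_mul hc.locallyIntegrable)
    ((hφ.pd i).integrable_mul hf.continuous.locallyIntegrable)
    (hφ.integrable_mul hf.continuous.locallyIntegrable)
    (fun x _ => (hf.differentiable (by simp)) x) (fun x _ => hφ.differentiable x)

theorem integral_mul_lap {f φ : E3 → ℝ} (hf : ContDiff ℝ ∞ f) (hφ : IsTest φ) :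
    ∫ x, f x * lap φ x = ∫ x, lap f x * φ x := by
  simp only [lap, Finset.mul_sum, Finset.sum_mul]
  rw [integral_finsetSum, integral_finsetSum]
  · refine Finset.sum_congr rfl fun i _ => ?_
    rw [integral_mul_pd (hf.of_le (by simp)) (hφ.pd i) i,
      integral_mul_pd ((ContDiff.pd hf i).of_le (by simp)) hφ i, neg_neg]
  · exact fun i _ => hφ.integrable_mul
      (ContDiff.pd (ContDiff.pd hf i) i).continuous.locallyIntegrable
  · exact fun i _ => ((hφ.pd i).pd i).integrable_mul hf.continuous.locallyIntegrable

/-! ### Weak gradients -/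

theorem integral_apply {F : E3 → E3} (hF : Integrable F) (i : Fin 3) :
    (∫ x, F x) i = ∫ x, F x i :=
  ((EuclideanSpace.proj i : E3 →L[ℝ] ℝ).integral_comp_comm hF).symm

theorem continuous_gradient {φ : E3 → ℝ} (h : ContDiff ℝ ∞ φ) : Continuous (gradient φ) :=
  (InnerProductSpace.toDual ℝ E3).symm.continuous.comp (h.continuous_fderiv (by simp))

theorem hasCompactSupport_gradient {φ : E3 → ℝ} (h : HasCompactSupport φ) :
    HasCompactSupport (gradient φ) :=
  (h.fderiv ℝ).comp_left (g := (InnerProductSpace.toDual ℝ E3).symm) (map_zero _)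

theorem LocallyIntegrable.coord {g : E3 → E3} (hg : LocallyIntegrable g) (i : Fin 3) :
    LocallyIntegrable fun x => g x i := fun x => by
  obtain ⟨s, hs, h⟩ := hg x
  exact ⟨s, hs, (EuclideanSpace.proj i : E3 →L[ℝ] ℝ).integrable_comp h⟩

theorem MemLp.coord {g : E3 → E3} {p : ℝ≥0∞} {μ : Measure E3} (hg : MemLp g p μ) (i : Fin 3) :
    MemLp (fun x => g x i) p μ :=
  (EuclideanSpace.proj i : E3 →L[ℝ] ℝ).comp_memLp' hg

/-- The weak gradient, coordinate by coordinate. -/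
theorem hasWeakGradient_iff {u : E3 → ℝ} {g : E3 → E3} :
    HasWeakGradient u g ↔ LocallyIntegrable u volume ∧ LocallyIntegrable g volume ∧
      ∀ φ, IsTest φ → ∀ i, ∫ x, u x * pd i φ x = - ∫ x, φ x * g x i := by
  refine and_congr_right fun hu => and_congr_right fun hg => ?_
  have key : ∀ φ, IsTest φ → ((∫ x, u x • gradient φ x = - ∫ x, φ x • g x) ↔
      ∀ i, ∫ x, u x * pd i φ x = - ∫ x, φ x * g x i) := by
    intro φ hφ
    have h1 : Integrable fun x => u x • gradient φ x :=
      hu.integrable_smul_right_of_hasCompactSupport (continuous_gradient hφ.smooth)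
        (hasCompactSupport_gradient hφ.supp)
    have h2 : Integrable fun x => φ x • g x :=
      hg.integrable_smul_left_of_hasCompactSupport hφ.continuous hφ.supp
    rw [PiLp.ext_iff]
    refine forall_congr' fun i => ?_
    rw [PiLp.neg_apply, integral_apply h1, integral_apply h2]
    simp [gradient_apply]
  exact ⟨fun h φ hφ => (key φ hφ).1 (h φ hφ.smooth hφ.supp),
    fun h φ h1 h2 => (key φ ⟨h1, h2⟩).2 (h φ ⟨h1, h2⟩)⟩

theorem HasWeakGradient.integral_pd {u : E3 → ℝ} {g : E3 → E3} (h : HasWeakGradient u g)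
    {φ : E3 → ℝ} (hφ : IsTest φ) (i : Fin 3) :
    ∫ x, u x * pd i φ x = - ∫ x, φ x * g x i :=
  (hasWeakGradient_iff.1 h).2.2 φ hφ i

theorem HasWeakGradient.ae_eq {u : E3 → ℝ} {g g' : E3 → E3} (h : HasWeakGradient u g)
    (h' : HasWeakGradient u g') : g =ᵐ[volume] g' := by
  refine ae_eq_of_integral_contDiff_smul_eq h.2.1 h'.2.1 fun φ h1 h2 => ?_
  rw [← neg_inj, ← h.2.2 φ h1 h2, h'.2.2 φ h1 h2]

theorem HasWeakGradient.weakGrad_ae_eq {u : E3 → ℝ} {g : E3 → E3} (h : HasWeakGradient u g) :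
    weakGrad u =ᵐ[volume] g :=
  HasWeakGradient.ae_eq (Classical.epsilon_spec ⟨g, h⟩) h

theorem MemH1.hasWeakGradient {u : E3 → ℝ} (h : MemH1 u) : HasWeakGradient u (weakGrad u) := by
  obtain ⟨_, g, hg, _⟩ := h
  exact Classical.epsilon_spec ⟨g, hg⟩

theorem MemH1.memLp_weakGrad {u : E3 → ℝ} (h : MemH1 u) : MemLp (weakGrad u) 2 := by
  obtain ⟨_, g, hg, hg2⟩ := h
  exact (memLp_congr_ae hg.weakGrad_ae_eq).2 hg2

theorem HasWeakGradient.linear {u w : E3 → ℝ} {g k : E3 → E3} (hu : HasWeakGradient u g)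
    (hw : HasWeakGradient w k) (a b : ℝ) :
    HasWeakGradient (fun x => a * u x + b * w x) (fun x => a • g x + b • k x) := by
  rw [hasWeakGradient_iff] at *
  obtain ⟨hu1, hg1, hu⟩ := hu
  obtain ⟨hw1, hk1, hw⟩ := hw
  refine ⟨(hu1.smul a).add (hw1.smul b), (hg1.smul a).add (hk1.smul b), fun φ hφ i => ?_⟩
  have i1 := (hφ.pd i).integrable_mul hu1
  have i2 := (hφ.pd i).integrable_mul hw1
  have i3 := hφ.integrable_mul (LocallyIntegrable.coord hg1 i)
  have i4 := hφ.integrable_mul (LocallyIntegrable.coord hk1 i)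
  have h1 := hu φ hφ i
  have h2 := hw φ hφ i
  simp only [mul_comm (φ _)] at h1 h2
  calc ∫ x, (a * u x + b * w x) * pd i φ x
      = ∫ x, (a * (u x * pd i φ x) + b * (w x * pd i φ x)) := by congr 1; ext x; ring
    _ = a * (∫ x, u x * pd i φ x) + b * ∫ x, w x * pd i φ x := by
        rw [integral_add (i1.const_mul a) (i2.const_mul b), integral_const_mul, integral_const_mul]
    _ = - ∫ x, (a * (g x i * φ x) + b * (k x i * φ x)) := by
        rw [integral_add (i3.const_mul a) (i4.const_mul b), integral_const_mul, integral_const_mul,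
          h1, h2]
        ring
    _ = _ := by
        congr 2; ext x; simp; ring

theorem MemH1.linear {u w : E3 → ℝ} (hu : MemH1 u) (hw : MemH1 w) (a b : ℝ) :
    MemH1 (fun x => a * u x + b * w x) :=
  ⟨(hu.1.const_mul a).add (hw.1.const_mul b), _, hu.hasWeakGradient.linear hw.hasWeakGradient a b,
    (hu.memLp_weakGrad.const_smul a).add (hw.memLp_weakGrad.const_smul b)⟩

theorem hasWeakGradient_of_contDiff {f : E3 → ℝ} (hf : ContDiff ℝ ∞ f) :
    HasWeakGradient f (gradient f) := by
  rw [hasWeakGradient_iff]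
  refine ⟨hf.continuous.locallyIntegrable, (continuous_gradient hf).locallyIntegrable,
    fun φ hφ i => ?_⟩
  rw [integral_mul_pd (hf.of_le (by simp)) hφ]
  simp [gradient_apply, mul_comm]

theorem IsTest.memH1 {φ : E3 → ℝ} (hφ : IsTest φ) : MemH1 φ :=
  ⟨hφ.memLp 2, _, hasWeakGradient_of_contDiff hφ.smooth,
    (continuous_gradient hφ.smooth).memLp_of_hasCompactSupport (hasCompactSupport_gradient hφ.supp)⟩

/-- The product rule with a smooth factor. -/
theorem HasWeakGradient.mul_smooth {u ψ : E3 → ℝ} {g : E3 → E3} (hu : HasWeakGradient u g)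
    (hψ : ContDiff ℝ ∞ ψ) :
    HasWeakGradient (fun x => ψ x * u x) (fun x => ψ x • g x + u x • gradient ψ x) := by
  rw [hasWeakGradient_iff] at *
  obtain ⟨hu1, hg1, hu⟩ := hu
  have l1 : LocallyIntegrable fun x => ψ x * u x := by
    rw [locallyIntegrable_iff] at *
    exact fun K hK => (hu1 K hK).continuousOn_mul hψ.continuous.continuousOn hK
  have l2 : LocallyIntegrable fun x => ψ x • g x := by
    rw [locallyIntegrable_iff] at *
    exact fun K hK => (hg1 K hK).continuousOn_smul hψ.continuous.continuousOn hK
  have l3 : LocallyIntegrable fun x => u x • gradient ψ x := by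
    rw [locallyIntegrable_iff] at *
    exact fun K hK => (hu1 K hK).smul_continuousOn (continuous_gradient hψ).continuousOn hK
  refine ⟨l1, l2.add l3, fun φ hφ i => ?_⟩
  have h1 := hu _ (hφ.mul_left hψ) i
  have e1 : (fun x => u x * pd i (fun x => ψ x * φ x) x) =
      fun x => ψ x * u x * pd i φ x + φ x * (u x * pd i ψ x) := by
    ext x
    rw [pd_mul (hψ.differentiable (by simp) x) (hφ.differentiable x)]
    ring
  have i1 := (hφ.pd i).integrable_mul l1
  have i2 : Integrable fun x => φ x * (u x * pd i ψ x) := by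
    have := hφ.integrable_mul (LocallyIntegrable.coord l3 i)
    simpa [gradient_apply, mul_comm] using this
  have i3 : Integrable fun x => φ x * (ψ x * g x i) := by
    have := hφ.integrable_mul (LocallyIntegrable.coord l2 i)
    simpa [mul_comm] using this
  rw [e1, integral_add i1 i2] at h1
  have e2 : (fun x => φ x * (ψ x • g x + u x • gradient ψ x) i) =
      fun x => φ x * (ψ x * g x i) + φ x * (u x * pd i ψ x) := by
    ext x; simp [gradient_apply]; ring
  have e3 : ∫ x, ψ x * φ x * g x i = ∫ x, φ x * (ψ x * g x i) := by congr 1; ext x; ring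
  rw [e2, integral_add i3 i2, ← e3]
  linarith

/-! ### Mollification -/

/-- A sequence of bump functions shrinking to the origin. -/
def bump (n : ℕ) : ContDiffBump (0 : E3) where
  rIn := 1 / (n + 1)
  rOut := 2 / (n + 1)
  rIn_pos := by positivity
  rIn_lt_rOut := by gcongr; norm_num

/-- The mollification `ρₙ ⋆ h`. -/
def mol (n : ℕ) (h : E3 → ℝ) : E3 → ℝ :=
  (bump n).normed volume ⋆[ContinuousLinearMap.lsmul ℝ ℝ, volume] h

theorem tendsto_bump_rOut : Tendsto (fun n => (bump n).rOut) atTop (𝓝 0) := by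
  have := (tendsto_one_div_add_atTop_nhds_zero_nat (𝕜 := ℝ)).const_mul 2
  simpa [bump, div_eq_mul_inv] using this

theorem isTest_bump (n : ℕ) : IsTest ((bump n).normed volume) :=
  ⟨(bump n).contDiff_normed, (bump n).hasCompactSupport_normed⟩

theorem mol_apply (n : ℕ) (h : E3 → ℝ) (x : E3) :
    mol n h x = ∫ t, (bump n).normed volume t * h (x - t) := rfl

theorem mol_apply_swap (n : ℕ) (h : E3 → ℝ) (x : E3) :
    mol n h x = ∫ t, (bump n).normed volume (x - t) * h t := by
  rw [mol, convolution_eq_swap]; rfl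

theorem contDiff_mol (n : ℕ) {h : E3 → ℝ} (hh : LocallyIntegrable h) : ContDiff ℝ ∞ (mol n h) :=
  (isTest_bump n).supp.contDiff_convolution_left _ (isTest_bump n).smooth hh

theorem ae_tendsto_mol {h : E3 → ℝ} (hh : LocallyIntegrable h) :
    ∀ᵐ x, Tendsto (fun n => mol n h x) atTop (𝓝 (h x)) := by
  refine ContDiffBump.ae_convolution_tendsto_right_of_locallyIntegrable (K := 2)
    tendsto_bump_rOut (Eventually.of_forall fun n => ?_) hh
  simp [bump, div_eq_mul_inv]

/-- Mollification commutes with weak differentiation. -/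
theorem pd_mol {u : E3 → ℝ} {g : E3 → E3} (h : HasWeakGradient u g) (n : ℕ) (i : Fin 3) :
    pd i (mol n u) = mol n (fun x => g x i) := by
  ext x
  have h1 := (isTest_bump n).supp.hasFDerivAt_convolution_left (μ := volume)
    (ContinuousLinearMap.lsmul ℝ ℝ) ((isTest_bump n).smooth.of_le (by simp)) h.1 x
  have h2 := h.integral_pd ((isTest_bump n).sub_left x) i
  have e : (fun y => u y * pd i (fun y => (bump n).normed volume (x - y)) y) =
      fun y => - (pd i ((bump n).normed volume) (x - y) * u y) := by
    ext y; rw [pd_sub_left]; ring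
  rw [e, integral_neg, neg_inj] at h2
  rw [mol_apply_swap, ← h2, pd]
  change fderiv ℝ ((bump n).normed volume ⋆[ContinuousLinearMap.lsmul ℝ ℝ, volume] u) x _ = _
  rw [h1.fderiv, convolution_eq_swap, ContinuousLinearMap.integral_apply]
  · rfl
  · exact (((isTest_bump n).supp.fderiv ℝ).convolutionExists_left _
      ((isTest_bump n).smooth.continuous_fderiv (by simp)) h.1 x).integrable_swap

/-- Translations act continuously on `L²`. -/
theorem tendsto_eLpNorm_translate {h : E3 → ℝ} (hh : MemLp h 2) :
    Tendsto (fun t : E3 => eLpNorm (fun x => h (x - t) - h x) 2) (𝓝 0) (𝓝 0) := by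
  let G : C(E3, C(E3, E3)) := (ContinuousMap.mk (fun p : E3 × E3 => p.2 - p.1)).curry
  have hG : ∀ t, MeasurePreserving (G t) volume volume := fun t => measurePreserving_sub_right _ t
  have h0 := Filter.Tendsto.compMeasurePreservingLp (p := 2) (l := 𝓝 (0 : E3))
    (f := fun _ => hh.toLp h) (f₀ := hh.toLp h) tendsto_const_nhds (G.continuous.tendsto 0) hG
    (hG 0) (by simp)
  rw [tendsto_iff_edist_tendsto_0] at h0
  refine h0.congr fun t => ?_
  rw [Lp.edist_def]
  refine eLpNorm_congr_ae ?_
  have key : ∀ s, (Lp.compMeasurePreserving (G s) (hG s) (hh.toLp h) : E3 → ℝ) =ᵐ[volume]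
      fun x => h (x - s) := fun s =>
    (Lp.coeFn_compMeasurePreserving _ (hG s)).trans
      ((hG s).quasiMeasurePreserving.ae_eq_comp hh.coeFn_toLp)
  filter_upwards [key t, key 0] with x h1 h2
  rw [Pi.sub_apply, h1, h2, sub_zero]

/-- Mollifications of a square integrable function converge in `L¹` on compact sets. -/
theorem tendsto_lintegral_mol {h φ : E3 → ℝ} (hh : MemLp h 2) (hφ : IsTest φ) :
    Tendsto (fun n => ∫⁻ x, ‖φ x‖ₑ * ‖mol n h x - h x‖ₑ) atTop (𝓝 0) := by
  have hloc : LocallyIntegrable h := hh.locallyIntegrable (by norm_num)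
  obtain ⟨h', hm', hae⟩ := hh.1
  have hh' : MemLp h' 2 := (memLp_congr_ae hae).1 hh
  set T : E3 → ℝ≥0∞ := fun t => ∫⁻ x, ‖φ x‖ₑ * ‖h' (x - t) - h' x‖ₑ with hT
  have hT0 : Tendsto T (𝓝 0) (𝓝 0) := by
    have h1 : ∀ t, T t ≤ eLpNorm φ 2 * eLpNorm (fun x => h' (x - t) - h' x) 2 := by
      intro t
      have := ENNReal.lintegral_mul_le_Lp_mul_Lq volume (Real.HolderConjugate.two_two)
        (f := fun x => ‖φ x‖ₑ) (g := fun x => ‖h' (x - t) - h' x‖ₑ)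
        hφ.continuous.aemeasurable.enorm
        ((hm'.measurable.comp (measurable_id.sub_const t)).sub hm'.measurable).enorm.aemeasurable
      simpa [eLpNorm_eq_lintegral_rpow_enorm_toReal] using this
    have hfin : eLpNorm φ 2 ≠ ⊤ := (hφ.memLp 2).eLpNorm_ne_top
    have h2 : Tendsto (fun t => eLpNorm φ 2 * eLpNorm (fun x => h' (x - t) - h' x) 2) (𝓝 0)
        (𝓝 (eLpNorm φ 2 * 0)) :=
      ENNReal.Tendsto.const_mul (tendsto_eLpNorm_translate hh') (Or.inr hfin)
    rw [mul_zero] at h2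
    exact ENNReal.tendsto_nhds_zero.2 fun ε hε =>
      (ENNReal.tendsto_nhds_zero.1 h2 ε hε).mono fun t ht => (h1 t).trans ht
  have hb : ∀ n, ∫⁻ x, ‖φ x‖ₑ * ‖mol n h x - h x‖ₑ ≤
      ∫⁻ t, ‖(bump n).normed volume t‖ₑ * T t := by
    intro n
    set ρ := (bump n).normed volume with hρ
    have hint : ∀ x, Integrable fun t => ρ t * h (x - t) := fun x =>
      ((isTest_bump n).supp.convolutionExists_left (ContinuousLinearMap.lsmul ℝ ℝ)
        (isTest_bump n).continuous hloc x).integrable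
    calc ∫⁻ x, ‖φ x‖ₑ * ‖mol n h x - h x‖ₑ
        ≤ ∫⁻ x, ‖φ x‖ₑ * ∫⁻ t, ‖ρ t‖ₑ * ‖h (x - t) - h x‖ₑ := by
          refine lintegral_mono fun x => ?_
          gcongr
          have e : mol n h x - h x = ∫ t, ρ t * (h (x - t) - h x) := by
            simp only [mul_sub]
            rw [integral_sub (hint x) ((isTest_bump n).integrable.mul_const _), mol_apply,
              integral_mul_const, hρ, (bump n).integral_normed, one_mul]
          rw [e]
          refine (enorm_integral_le_lintegral_enorm _).trans (le_of_eq ?_)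
          simp [enorm_mul]
      _ = ∫⁻ x, ∫⁻ t, ‖φ x‖ₑ * (‖ρ t‖ₑ * ‖h' (x - t) - h' x‖ₑ) := by
          refine lintegral_congr_ae (hae.mono fun x hx => ?_)
          have hx2 : ∀ᵐ t, h (x - t) = h' (x - t) :=
            (quasiMeasurePreserving_sub_left volume x).ae hae
          simp only
          rw [← lintegral_const_mul' _ _ enorm_ne_top]
          exact lintegral_congr_ae (hx2.mono fun t ht => by simp only [ht, hx])
      _ = ∫⁻ t, ∫⁻ x, ‖φ x‖ₑ * (‖ρ t‖ₑ * ‖h' (x - t) - h' x‖ₑ) := by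
          refine lintegral_lintegral_swap (Measurable.aemeasurable ?_)
          have m1 := hφ.continuous.measurable
          have m2 := (isTest_bump n).continuous.measurable
          have m3 := hm'.measurable
          exact (m1.comp measurable_fst).enorm.mul ((m2.comp measurable_snd).enorm.mul
            ((m3.comp (measurable_fst.sub measurable_snd)).sub (m3.comp measurable_fst)).enorm)
      _ = ∫⁻ t, ‖ρ t‖ₑ * T t := by
          refine lintegral_congr fun t => ?_
          rw [hT, ← lintegral_const_mul' _ _ enorm_ne_top]
          exact lintegral_congr fun x => by ring
  rw [ENNReal.tendsto_atTop_zero]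
  intro ε hε
  obtain ⟨δ, hδ, hball⟩ := Metric.eventually_nhds_iff.1
    ((ENNReal.tendsto_nhds_zero.1 hT0) ε hε)
  obtain ⟨N, hN⟩ := eventually_atTop.1 (tendsto_bump_rOut.eventually (gt_mem_nhds hδ))
  refine ⟨N, fun n hn => (hb n).trans ?_⟩
  calc ∫⁻ t, ‖(bump n).normed volume t‖ₑ * T t
      ≤ ∫⁻ t, ‖(bump n).normed volume t‖ₑ * ε := by
        refine lintegral_mono fun t => ?_
        by_cases ht : (bump n).normed volume t = 0
        · simp [ht]
        · gcongr
          have : t ∈ Metric.ball (0 : E3) (bump n).rOut := by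
            rw [← (bump n).support_normed_eq (μ := volume)]; exact ht
          exact hball (lt_trans (Metric.mem_ball.1 this) (hN n hn))
    _ = ε := by
        have h1 : ∫⁻ t, ‖(bump n).normed volume t‖ₑ = 1 := by
          rw [← ENNReal.ofReal_one, ← (bump n).integral_normed (μ := volume),
            ofReal_integral_eq_lintegral_ofReal (isTest_bump n).integrable
              (Eventually.of_forall fun x => (bump n).nonneg_normed x)]
          exact lintegral_congr fun t => Real.enorm_of_nonneg ((bump n).nonneg_normed t)
        rw [lintegral_mul_const _ (isTest_bump n).continuous.measurable.enorm, h1, one_mul]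

/-! ### The chain rule -/

theorem abs_sub_le_of_abs_deriv_le {H : ℝ → ℝ} (hH : ContDiff ℝ ∞ H) {C : ℝ}
    (hC : ∀ t, |deriv H t| ≤ C) (a b : ℝ) : |H a - H b| ≤ C * |a - b| :=
  Convex.norm_image_sub_le_of_norm_deriv_le (s := univ)
    (fun x _ => hH.differentiable (by simp) x) (fun x _ => hC x) convex_univ (mem_univ b)
    (mem_univ a)

/-- The chain rule in `H¹`, for a smooth function with bounded derivative. -/
theorem HasWeakGradient.comp {u : E3 → ℝ} {g : E3 → E3} (h : HasWeakGradient u g)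
    (hu : MemLp u 2) (hg : MemLp g 2) {H : ℝ → ℝ} (hH : ContDiff ℝ ∞ H) {C : ℝ}
    (hC : ∀ t, |deriv H t| ≤ C) :
    HasWeakGradient (fun x => H (u x)) (fun x => deriv H (u x) • g x) := by
  have hC0 : 0 ≤ C := (abs_nonneg _).trans (hC 0)
  have hH' : Continuous (deriv H) := hH.continuous_deriv (by simp)
  have hlip := abs_sub_le_of_abs_deriv_le hH hC
  have l1 : LocallyIntegrable fun x => H (u x) := by
    refine ((locallyIntegrable_const |H 0|).add
      (LocallyIntegrable.smul (fun x => (h.1 x).norm) C)).mono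
      (hH.continuous.comp_aestronglyMeasurable hu.1) (Eventually.of_forall fun x => ?_)
    have h1 := hlip (u x) 0
    have h2 := abs_sub_abs_le_abs_sub (H (u x)) (H 0)
    rw [sub_zero] at h1
    simp only [Real.norm_eq_abs, Pi.add_apply, Pi.smul_apply, smul_eq_mul]
    rw [abs_of_nonneg (a := |H 0| + C * |u x|) (by positivity)]
    linarith
  have l2 : LocallyIntegrable fun x => deriv H (u x) • g x := by
    refine (LocallyIntegrable.smul (fun x => (h.2.1 x).norm) C).mono
      ((hH'.comp_aestronglyMeasurable hu.1).smul hg.1)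
      (Eventually.of_forall fun x => ?_)
    simp only [Pi.smul_apply, smul_eq_mul, norm_smul, norm_mul, norm_norm]
    exact mul_le_mul_of_nonneg_right ((hC _).trans (le_abs_self C)) (norm_nonneg _)
  refine hasWeakGradient_iff.2 ⟨l1, l2, fun φ hφ i => ?_⟩
  have sm : ∀ n, ContDiff ℝ ∞ (mol n u) := fun n => contDiff_mol n h.1
  have hgi : MemLp (fun x => g x i) 2 := MemLp.coord hg i
  have hgl : LocallyIntegrable (fun x => g x i) := LocallyIntegrable.coord h.2.1 i
  have smg : ∀ n, ContDiff ℝ ∞ (mol n fun x => g x i) := fun n => contDiff_mol n hgl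
  -- The identity holds for the mollifications.
  have hn : ∀ n, ∫ x, H (mol n u x) * pd i φ x =
      - ((∫ x, φ x * deriv H (mol n u x) * (mol n (fun x => g x i) x - g x i)) +
        ∫ x, deriv H (mol n u x) * (φ x * g x i)) := by
    intro n
    have hc : Continuous fun x => φ x * deriv H (mol n u x) :=
      hφ.continuous.mul (hH'.comp (sm n).continuous)
    have hcs : HasCompactSupport fun x => φ x * deriv H (mol n u x) := hφ.supp.mul_right
    have hi : ∀ {f : E3 → ℝ}, LocallyIntegrable f →
        Integrable fun x => φ x * deriv H (mol n u x) * f x := fun hf =>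
      hf.integrable_smul_left_of_hasCompactSupport hc hcs
    rw [integral_mul_pd (f := fun x => H (mol n u x)) ((hH.comp (sm n)).of_le (by simp)) hφ i]
    have e : ∀ x, pd i (fun x => H (mol n u x)) x =
        deriv H (mol n u x) * mol n (fun x => g x i) x := by
      intro x
      rw [← pd_mol h n i, pd, pd,
        fderiv_fun_comp x ((hH.differentiable (by simp)) _) ((sm n).differentiable (by simp) x)]
      simp [mul_comm]
    have e2 : ∫ x, deriv H (mol n u x) * (φ x * g x i) =
        ∫ x, φ x * deriv H (mol n u x) * g x i := by congr 1; ext x; ring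
    simp only [mul_sub]
    rw [integral_sub (hi (smg n).continuous.locallyIntegrable) (hi hgl), e2, sub_add_cancel]
    congr 2
    ext x
    rw [e]
    ring
  -- No bound on `H` is available, but it is Lipschitz: `L¹` convergence on compact sets suffices.
  have lim1 : Tendsto (fun n => ∫ x, H (mol n u x) * pd i φ x) atTop
      (𝓝 (∫ x, H (u x) * pd i φ x)) := by
    refine tendsto_integral_of_L1 _ ((hφ.pd i).integrable_mul l1).1 (Eventually.of_forall fun n =>
      (hφ.pd i).integrable_mul (hH.continuous.comp (sm n).continuous).locallyIntegrable) ?_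
    have h0 := ENNReal.Tendsto.const_mul (a := ENNReal.ofReal C)
      (tendsto_lintegral_mol hu (hφ.pd i)) (Or.inr ENNReal.ofReal_ne_top)
    rw [mul_zero] at h0
    refine tendsto_of_tendsto_of_tendsto_of_le_of_le tendsto_const_nhds h0
      (fun _ => zero_le) fun n => ?_
    simp only
    rw [← lintegral_const_mul' _ _ ENNReal.ofReal_ne_top]
    refine lintegral_mono fun x => ?_
    rw [← sub_mul, ← Real.enorm_of_nonneg hC0, ← enorm_mul, ← enorm_mul, enorm_le_iff_norm_le]
    simp only [norm_mul, Real.norm_eq_abs, abs_of_nonneg hC0]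
    have := hlip (mol n u x) (u x)
    nlinarith [abs_nonneg (pd i φ x)]
  have lim2 : Tendsto (fun n => ∫ x, φ x * deriv H (mol n u x) *
      (mol n (fun x => g x i) x - g x i)) atTop (𝓝 (∫ _ : E3, (0 : ℝ))) := by
    refine tendsto_integral_of_L1 _ aestronglyMeasurable_const (Eventually.of_forall fun n => ?_) ?_
    · exact ((smg n).continuous.locallyIntegrable.sub hgl).integrable_smul_left_of_hasCompactSupport
        (hφ.continuous.mul (hH'.comp (sm n).continuous)) hφ.supp.mul_right
    have h0 := ENNReal.Tendsto.const_mul (a := ENNReal.ofReal C)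
      (tendsto_lintegral_mol hgi hφ) (Or.inr ENNReal.ofReal_ne_top)
    rw [mul_zero] at h0
    refine tendsto_of_tendsto_of_tendsto_of_le_of_le tendsto_const_nhds h0
      (fun _ => zero_le) fun n => ?_
    simp only
    rw [← lintegral_const_mul' _ _ ENNReal.ofReal_ne_top]
    refine lintegral_mono fun x => ?_
    rw [sub_zero, ← Real.enorm_of_nonneg hC0, ← enorm_mul, ← enorm_mul, enorm_le_iff_norm_le]
    simp only [norm_mul, Real.norm_eq_abs, abs_of_nonneg hC0]
    rw [mul_comm |φ x|, mul_assoc]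
    gcongr
    exact hC _
  -- Here the gradient is fixed, so almost everywhere convergence and dominated convergence apply.
  have lim3 : Tendsto (fun n => ∫ x, deriv H (mol n u x) * (φ x * g x i)) atTop
      (𝓝 (∫ x, deriv H (u x) * (φ x * g x i))) := by
    have hint : Integrable fun x => φ x * g x i := by
      simpa [mul_comm] using hφ.integrable_mul hgl
    refine tendsto_integral_of_dominated_convergence (fun x => C * ‖φ x * g x i‖)
      (fun n => ((hH'.comp (sm n).continuous).aestronglyMeasurable).mul hint.1)
      (hint.norm.const_mul C) (fun n => Eventually.of_forall fun x => ?_) ?_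
    · rw [norm_mul]
      gcongr
      exact hC _
    · filter_upwards [ae_tendsto_mol h.1] with x hx
      exact ((hH'.tendsto _).comp hx).mul_const _
  have := tendsto_nhds_unique lim1 ((lim2.add lim3).neg.congr fun n => (hn n).symm)
  rw [this, integral_zero, zero_add]
  congr 2
  ext x
  simp only [PiLp.smul_apply, smul_eq_mul]
  ring

/-- The condition `H 0 = 0` keeps the composition square integrable on the whole space. -/
theorem MemH1.comp {u : E3 → ℝ} (h : MemH1 u) {H : ℝ → ℝ} (hH : ContDiff ℝ ∞ H) (h0 : H 0 = 0)
    {C : ℝ} (hC : ∀ t, |deriv H t| ≤ C) :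
    MemH1 (fun x => H (u x)) ∧
      weakGrad (fun x => H (u x)) =ᵐ[volume] fun x => deriv H (u x) • weakGrad u x := by
  have hw := h.hasWeakGradient.comp h.1 h.memLp_weakGrad hH hC
  refine ⟨⟨?_, _, hw, ?_⟩, hw.weakGrad_ae_eq⟩
  · refine h.1.of_le_mul (c := C) (hH.continuous.comp_aestronglyMeasurable h.1.1)
      (Eventually.of_forall fun x => ?_)
    simpa [h0] using abs_sub_le_of_abs_deriv_le hH hC (u x) 0
  · refine h.memLp_weakGrad.of_le_mul (c := C)
      (((hH.continuous_deriv (by simp)).comp_aestronglyMeasurable h.1.1).smul h.memLp_weakGrad.1)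
      (Eventually.of_forall fun x => ?_)
    rw [norm_smul]
    gcongr
    exact hC _

/-! ### Capacity -/

theorem capacity_mono {A B : Set E3} (h : A ⊆ B) : capacity A ≤ capacity B :=
  iInf_mono fun _ => iInf_mono fun _ => iInf_mono' fun ⟨U, hU, hBU, hw⟩ =>
    ⟨⟨U, hU, h.trans hBU, hw⟩, le_rfl⟩

theorem isTest_zero : IsTest (fun _ => 0) := ⟨contDiff_const, HasCompactSupport.zero⟩

theorem capacity_empty : capacity ∅ = 0 := by
  have h0 := isTest_zero.memH1
  have hg : weakGrad (fun _ : E3 => (0 : ℝ)) =ᵐ[volume] fun _ => 0 := by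
    refine (hasWeakGradient_of_contDiff contDiff_const).weakGrad_ae_eq.trans
      (Eventually.of_forall fun x => ?_)
    simp [gradient]
  refine le_antisymm ?_ zero_le
  refine iInf_le_of_le _ (iInf_le_of_le h0 (iInf_le_of_le ⟨∅, isOpen_empty, subset_rfl, ?_⟩ ?_))
  · simp
  · have : ∫ x, ‖weakGrad (fun _ : E3 => (0 : ℝ)) x‖ ^ 2 = 0 :=
      integral_eq_zero_of_ae (hg.mono fun x hx => by simp [hx])
    simp [this]

theorem exists_of_capacity_lt {A : Set E3} {ε : ℝ≥0∞} (h : capacity A < ε) :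
    ∃ w, MemH1 w ∧ (∃ U : Set E3, IsOpen U ∧ A ⊆ U ∧ ∀ᵐ x ∂(volume.restrict U), 1 ≤ w x) ∧
      ENNReal.ofReal ((∫ x, w x ^ 2) + ∫ x, ‖weakGrad w x‖ ^ 2) < ε := by
  simp only [capacity, iInf_lt_iff] at h
  obtain ⟨w, hw, hU, h⟩ := h
  exact ⟨w, hw, hU, h⟩

/-- A set of zero capacity is Lebesgue null. -/
theorem volume_eq_zero_of_capacity_eq_zero {A : Set E3} (h : capacity A = 0) : volume A = 0 := by
  refine nonpos_iff_eq_zero.1 (le_of_forall_gt_imp_ge_of_dense fun ε hε => ?_)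
  obtain ⟨w, hw, ⟨U, hU, hAU, hwU⟩, hlt⟩ := exists_of_capacity_lt (h.trans_lt hε)
  calc volume A ≤ volume U := measure_mono hAU
    _ = ∫⁻ _ in U, 1 := by simp
    _ ≤ ∫⁻ x in U, ENNReal.ofReal (w x ^ 2) := by
        refine lintegral_mono_ae (hwU.mono fun x hx => ?_)
        rw [ENNReal.one_le_ofReal]
        nlinarith
    _ ≤ ∫⁻ x, ENNReal.ofReal (w x ^ 2) := setLIntegral_le_lintegral _ _
    _ = ENNReal.ofReal (∫ x, w x ^ 2) :=
        (ofReal_integral_eq_lintegral_ofReal hw.1.integrable_sq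
          (Eventually.of_forall fun x => sq_nonneg _)).symm
    _ ≤ ENNReal.ofReal ((∫ x, w x ^ 2) + ∫ x, ‖weakGrad w x‖ ^ 2) := by
        refine ENNReal.ofReal_le_ofReal (le_add_of_nonneg_right ?_)
        exact integral_nonneg fun x => by positivity
    _ ≤ ε := hlt.le

/-- A smooth substitute for the positive part: it is nonnegative, dominated by `|t|`, Lipschitz, and
at least `1` for `t ≥ 1`. -/
def softPos (t : ℝ) : ℝ := 2 * t ^ 2 / (1 + t ^ 2)

theorem contDiff_softPos : ContDiff ℝ ∞ softPos := by
  refine ContDiff.div (by fun_prop) (by fun_prop) fun t => ?_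
  positivity

theorem abs_deriv_softPos_le (t : ℝ) : |deriv softPos t| ≤ 2 := by
  have h : HasDerivAt softPos (4 * t / (1 + t ^ 2) ^ 2) t := by
    have h1 : HasDerivAt (fun t : ℝ => 2 * t ^ 2) (2 * (2 * t)) t := by
      simpa using (hasDerivAt_pow 2 t).const_mul 2
    have h2 : HasDerivAt (fun t : ℝ => 1 + t ^ 2) (2 * t) t := by
      simpa using (hasDerivAt_pow 2 t).const_add 1
    convert! h1.div h2 (by positivity) using 1
    congr 1
    ring
  rw [h.deriv, abs_div, abs_mul, abs_of_pos (by positivity : (0 : ℝ) < 4),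
    abs_of_pos (by positivity : (0 : ℝ) < (1 + t ^ 2) ^ 2), div_le_iff₀ (by positivity),
    ← sq_abs t]
  nlinarith [sq_nonneg (|t| - 1), sq_nonneg (|t| ^ 2), abs_nonneg t]

theorem one_le_softPos {t : ℝ} (ht : 1 ≤ t) : 1 ≤ softPos t := by
  rw [softPos, one_le_div (by positivity)]
  nlinarith

theorem softPos_nonneg (t : ℝ) : 0 ≤ softPos t := by rw [softPos]; positivity

/-- Capacity is subadditive up to a constant factor. -/
theorem capacity_union_le {A B : Set E3} {ε : ℝ≥0∞} (hA : capacity A < ε) (hB : capacity B < ε) :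
    capacity (A ∪ B) ≤ 16 * ε := by
  obtain ⟨w, hw, ⟨U, hU, hAU, hwU⟩, hlt⟩ := exists_of_capacity_lt hA
  obtain ⟨z, hz, ⟨V, hV, hBV, hzV⟩, hlt'⟩ := exists_of_capacity_lt hB
  obtain ⟨hw1, hw2⟩ := hw.comp contDiff_softPos (by simp [softPos]) abs_deriv_softPos_le
  obtain ⟨hz1, hz2⟩ := hz.comp contDiff_softPos (by simp [softPos]) abs_deriv_softPos_le
  have hs := hw1.linear hz1 1 1
  have hsg := (hw1.hasWeakGradient.linear hz1.hasWeakGradient 1 1).weakGrad_ae_eq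
  have hle : ∀ t, |softPos t| ≤ 2 * |t| := fun t => by
    simpa [softPos] using abs_sub_le_of_abs_deriv_le contDiff_softPos abs_deriv_softPos_le t 0
  have b1 : ∫ x, (1 * softPos (w x) + 1 * softPos (z x)) ^ 2 ≤
      8 * (∫ x, w x ^ 2) + 8 * ∫ x, z x ^ 2 := by
    rw [← integral_const_mul, ← integral_const_mul, ← integral_add
      (hw.1.integrable_sq.const_mul _) (hz.1.integrable_sq.const_mul _)]
    refine integral_mono hs.1.integrable_sq
      ((hw.1.integrable_sq.const_mul _).add (hz.1.integrable_sq.const_mul _)) fun x => ?_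
    have h1 := hle (w x)
    have h2 := hle (z x)
    have h3 := sq_le_sq' (by linarith [abs_nonneg (softPos (w x)), abs_nonneg (w x)]) h1
    have h4 := sq_le_sq' (by linarith [abs_nonneg (softPos (z x)), abs_nonneg (z x)]) h2
    rw [mul_pow, sq_abs, sq_abs] at h3 h4
    simp only
    nlinarith [sq_nonneg (softPos (w x) - softPos (z x))]
  have b2 : ∫ x, ‖weakGrad (fun x => 1 * softPos (w x) + 1 * softPos (z x)) x‖ ^ 2 ≤
      8 * (∫ x, ‖weakGrad w x‖ ^ 2) + 8 * ∫ x, ‖weakGrad z x‖ ^ 2 := by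
    have i1 := (hw.memLp_weakGrad.integrable_norm_pow (by simp)).const_mul 8
    have i2 := (hz.memLp_weakGrad.integrable_norm_pow (by simp)).const_mul 8
    rw [← integral_const_mul, ← integral_const_mul, ← integral_add i1 i2]
    refine integral_mono_ae (hs.memLp_weakGrad.integrable_norm_pow (by simp)) (i1.add i2) ?_
    filter_upwards [hsg, hw2, hz2] with x h0 h1 h2
    simp only [h0, h1, h2, one_smul]
    have h3 : ‖deriv softPos (w x) • weakGrad w x‖ ≤ 2 * ‖weakGrad w x‖ := by
      rw [norm_smul]; gcongr; exact abs_deriv_softPos_le _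
    have h4 : ‖deriv softPos (z x) • weakGrad z x‖ ≤ 2 * ‖weakGrad z x‖ := by
      rw [norm_smul]; gcongr; exact abs_deriv_softPos_le _
    have h5 := (norm_add_le _ _).trans (add_le_add h3 h4)
    have h6 := pow_le_pow_left₀ (norm_nonneg _) h5 2
    nlinarith [sq_nonneg (‖weakGrad w x‖ - ‖weakGrad z x‖)]
  calc capacity (A ∪ B) ≤ ENNReal.ofReal ((∫ x, (1 * softPos (w x) + 1 * softPos (z x)) ^ 2) +
        ∫ x, ‖weakGrad (fun x => 1 * softPos (w x) + 1 * softPos (z x)) x‖ ^ 2) := by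
        refine iInf_le_of_le _ (iInf_le_of_le hs
          (iInf_le_of_le ⟨U ∪ V, hU.union hV, union_subset_union hAU hBV, ?_⟩ le_rfl))
        rw [ae_restrict_union_iff]
        refine ⟨hwU.mono fun x hx => ?_, hzV.mono fun x hx => ?_⟩
        · linarith [one_le_softPos hx, softPos_nonneg (z x)]
        · linarith [one_le_softPos hx, softPos_nonneg (w x)]
    _ ≤ ENNReal.ofReal (8 * ((∫ x, w x ^ 2) + ∫ x, ‖weakGrad w x‖ ^ 2) +
          8 * ((∫ x, z x ^ 2) + ∫ x, ‖weakGrad z x‖ ^ 2)) :=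
        ENNReal.ofReal_le_ofReal (by linarith)
    _ ≤ 8 * ENNReal.ofReal ((∫ x, w x ^ 2) + ∫ x, ‖weakGrad w x‖ ^ 2) +
          8 * ENNReal.ofReal ((∫ x, z x ^ 2) + ∫ x, ‖weakGrad z x‖ ^ 2) := by
        refine ENNReal.ofReal_add_le.trans ?_
        rw [ENNReal.ofReal_mul (by norm_num), ENNReal.ofReal_mul (by norm_num)]
        simp
    _ ≤ 8 * ε + 8 * ε := by gcongr
    _ = 16 * ε := by rw [← add_mul]; norm_num

theorem capacity_union_eq_zero {A B : Set E3} (hA : capacity A = 0) (hB : capacity B = 0) :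
    capacity (A ∪ B) = 0 := by
  refine nonpos_iff_eq_zero.1 (le_of_forall_gt_imp_ge_of_dense fun ε hε => ?_)
  have h : 0 < ε / 16 := ENNReal.div_pos hε.ne' (by simp)
  refine (capacity_union_le (hA.trans_lt h) (hB.trans_lt h)).trans (le_of_eq ?_)
  exact ENNReal.mul_div_cancel (by simp) (by simp)

/-! ### The space `H¹₀(Ω)` -/

theorem isQuasiContinuous_of_continuous {v : E3 → ℝ} (hv : Continuous v) : IsQuasiContinuous v :=
  fun ε hε => ⟨∅, isOpen_empty, by rwa [capacity_empty], hv.continuousOn⟩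

theorem IsQuasiContinuous.comp₂ {v w : E3 → ℝ} (hv : IsQuasiContinuous v)
    (hw : IsQuasiContinuous w) {F : E3 × ℝ × ℝ → ℝ} (hF : Continuous F) :
    IsQuasiContinuous fun x => F (x, v x, w x) := by
  intro ε hε
  obtain ⟨δ, hδ0, hδ⟩ := exists_between hε
  have h : 0 < δ / 16 := ENNReal.div_pos hδ0.ne' (by simp)
  obtain ⟨G, hG, hcG, hvG⟩ := hv _ h
  obtain ⟨K, hK, hcK, hwK⟩ := hw _ h
  refine ⟨G ∪ K, hG.union hK, ((capacity_union_le hcG hcK).trans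
    (le_of_eq (ENNReal.mul_div_cancel (by simp) (by simp)))).trans_lt hδ, ?_⟩
  refine hF.comp_continuousOn (continuousOn_id.prodMk ((hvG.mono ?_).prodMk (hwK.mono ?_)))
  · exact compl_subset_compl.2 subset_union_left
  · exact compl_subset_compl.2 subset_union_right

theorem MemH10.linear {Ω : Set E3} {u w : E3 → ℝ} (hu : MemH10 Ω u) (hw : MemH10 Ω w) (a b : ℝ) :
    MemH10 Ω (fun x => a * u x + b * w x) := by
  obtain ⟨hu1, v, hv, hvu, hv0⟩ := hu
  obtain ⟨hw1, z, hz, hzw, hz0⟩ := hw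
  refine ⟨hu1.linear hw1 a b, fun x => a * v x + b * z x,
    hv.comp₂ hz (F := fun p => a * p.2.1 + b * p.2.2) (by fun_prop), ?_, ?_⟩
  · filter_upwards [hvu, hzw] with x h1 h2
    rw [h1, h2]
  · refine nonpos_iff_eq_zero.1 ((capacity_mono ?_).trans (capacity_union_eq_zero hv0 hz0).le)
    rintro x ⟨hx, h⟩
    by_contra h'
    simp only [mem_union, mem_ofPred_eq, hx, not_false_eq_true, true_and, not_or, not_not] at h'
    exact h (by simp [h'.1, h'.2])

theorem IsTest.memH10 {Ω : Set E3} {φ : E3 → ℝ} (hφ : IsTest φ)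
    (h : capacity (Function.support φ \ Ω) = 0) : MemH10 Ω φ := by
  refine ⟨hφ.memH1, φ, isQuasiContinuous_of_continuous hφ.continuous, ae_eq_rfl, ?_⟩
  rw [← h]
  congr 1
  ext x
  simp [and_comm]

theorem MemH10.ae_eq_zero {Ω : Set E3} {u : E3 → ℝ} (hu : MemH10 Ω u) :
    ∀ᵐ x, x ∉ Ω → u x = 0 := by
  obtain ⟨-, v, -, hvu, hv0⟩ := hu
  have h := measure_eq_zero_iff_ae_notMem.1 (volume_eq_zero_of_capacity_eq_zero hv0)
  filter_upwards [hvu, h] with x h1 h2 hx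
  by_contra h3
  exact h2 ⟨hx, by rwa [h1]⟩

/-- Truncated test functions `ψ · h(u)`, for `u ∈ H¹₀(Ω)`, `h` smooth with bounded derivative and
vanishing at `0`, and `ψ` a test function, belong to `H¹₀(Ω)`. -/
theorem MemH10.mul_comp {Ω : Set E3} {u ψ : E3 → ℝ} (hu : MemH10 Ω u) (hψ : IsTest ψ)
    {h : ℝ → ℝ} (hh : ContDiff ℝ ∞ h) (h0 : h 0 = 0) {C : ℝ} (hC : ∀ t, |deriv h t| ≤ C)
    {B : ℝ} (hB : ∀ t, |h t| ≤ B) :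
    MemH10 Ω (fun x => ψ x * h (u x)) ∧ weakGrad (fun x => ψ x * h (u x)) =ᵐ[volume]
      fun x => ψ x • (deriv h (u x) • weakGrad u x) + h (u x) • gradient ψ x := by
  obtain ⟨hu1, v, hv, hvu, hv0⟩ := hu
  obtain ⟨h1, h2⟩ := hu1.comp hh h0 hC
  have hw : HasWeakGradient (fun x => h (u x)) (fun x => deriv h (u x) • weakGrad u x) :=
    hu1.hasWeakGradient.comp hu1.1 hu1.memLp_weakGrad hh hC
  have hw' := hw.mul_smooth hψ.smooth
  obtain ⟨M, hM0, hM⟩ := hψ.exists_bound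
  refine ⟨⟨⟨?_, _, hw', ?_⟩, fun x => ψ x * h (v x), ?_, ?_, ?_⟩, hw'.weakGrad_ae_eq⟩
  · refine h1.1.of_le_mul (c := M) (hψ.continuous.aestronglyMeasurable.mul h1.1.1)
      (Eventually.of_forall fun x => ?_)
    rw [norm_mul]
    gcongr
    exact hM x
  · refine MemLp.add ?_ ?_
    · refine ((memLp_congr_ae h2).1 h1.memLp_weakGrad).of_le_mul (c := M)
        (hψ.continuous.aestronglyMeasurable.smul
          ((memLp_congr_ae h2).1 h1.memLp_weakGrad).1) (Eventually.of_forall fun x => ?_)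
      rw [norm_smul]
      gcongr
      exact hM x
    · refine ((continuous_gradient hψ.smooth).memLp_of_hasCompactSupport
        (hasCompactSupport_gradient hψ.supp)).of_le_mul (c := B)
        (h1.1.1.smul (continuous_gradient hψ.smooth).aestronglyMeasurable)
        (Eventually.of_forall fun x => ?_)
      rw [norm_smul]
      gcongr
      exact hB _
  · exact hv.comp₂ hv (F := fun p => ψ p.1 * h p.2.1)
      ((hψ.continuous.comp continuous_fst).mul (hh.continuous.comp (by fun_prop)))
  · filter_upwards [hvu] with x hx
    rw [hx]
  · refine nonpos_iff_eq_zero.1 ((capacity_mono ?_).trans hv0.le)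
    rintro x ⟨hx, h'⟩
    refine ⟨hx, fun h3 => h' ?_⟩
    simp [h3, h0]

/-! ### The Coulomb kernel -/

section

theorem integrableOn_ball_norm_inv_pow {k : ℕ} (hk : k ≤ 2) (r : ℝ) :
    IntegrableOn (fun y : E3 => (‖y‖ ^ k)⁻¹) (Metric.ball 0 r) := by
  rw [integrableOn_fun_norm_addHaar volume (f := fun s : ℝ => (s ^ k)⁻¹)]
  have h : IntegrableOn (fun s : ℝ => s ^ (2 - k)) (Ioo 0 r) :=
    (continuous_pow _).locallyIntegrable.integrableOn_isCompact isCompact_Icc |>.mono_set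
      Ioo_subset_Icc_self
  refine h.congr_fun (fun s hs => ?_) measurableSet_Ioo
  have hs0 : s ≠ 0 := hs.1.ne'
  simp only [finrank_euclideanSpace, Fintype.card_fin, smul_eq_mul]
  rw [eq_mul_inv_iff_mul_eq₀ (pow_ne_zero _ hs0), ← pow_add, Nat.sub_add_cancel hk]

theorem locallyIntegrable_norm_inv_pow {k : ℕ} (hk : k ≤ 2) :
    LocallyIntegrable fun y : E3 => (‖y‖ ^ k)⁻¹ := fun x =>
  ⟨Metric.ball 0 (‖x‖ + 1), Metric.isOpen_ball.mem_nhds (by simp),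
    integrableOn_ball_norm_inv_pow hk _⟩

/-- The integral of `|y|⁻²` over the unit ball. -/
def ballConst : ℝ := ∫ y in Metric.ball (0 : E3) 1, (‖y‖ ^ 2)⁻¹

variable {Ω : Set E3}

theorem integrable_kernel_sq (hΩ : volume Ω ≠ ⊤) (x : E3) :
    Integrable (fun y => (‖x - y‖ ^ 2)⁻¹) (volume.restrict Ω) ∧
      ∫ y in Ω, (‖x - y‖ ^ 2)⁻¹ ≤ ballConst + volume.real Ω := by
  have : IsFiniteMeasure (volume.restrict Ω) := ⟨by simpa using hΩ.lt_top⟩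
  set b : E3 → ℝ := (Metric.ball 0 1).indicator fun y => (‖y‖ ^ 2)⁻¹ with hb
  have hb1 : Integrable b := (integrable_indicator_iff measurableSet_ball).2
    (integrableOn_ball_norm_inv_pow le_rfl 1)
  have hb2 : Integrable fun y => b (x - y) := hb1.comp_sub_left x
  have hb0 : ∀ z, 0 ≤ b z := fun z => indicator_nonneg (fun y _ => by positivity) z
  have hle : ∀ z : E3, (‖z‖ ^ 2)⁻¹ ≤ b z + 1 := by
    intro z
    by_cases hz : z ∈ Metric.ball (0 : E3) 1
    · simp [hb, indicator_of_mem hz]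
    · have h1 : 1 ≤ ‖z‖ := by simpa using hz
      have : (‖z‖ ^ 2)⁻¹ ≤ 1 := inv_le_one_of_one_le₀ (one_le_pow₀ h1)
      linarith [hb0 z]
  have hint : Integrable (fun y => b (x - y) + 1) (volume.restrict Ω) :=
    hb2.restrict.add (integrable_const 1)
  have hm : Integrable (fun y => (‖x - y‖ ^ 2)⁻¹) (volume.restrict Ω) := by
    refine hint.mono' (by fun_prop) (Eventually.of_forall fun y => ?_)
    rw [Real.norm_of_nonneg (by positivity)]
    exact hle _
  refine ⟨hm, ?_⟩
  calc ∫ y in Ω, (‖x - y‖ ^ 2)⁻¹ ≤ ∫ y in Ω, (b (x - y) + 1) :=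
        integral_mono hm hint fun y => hle _
    _ = (∫ y in Ω, b (x - y)) + volume.real Ω := by
        rw [integral_add hb2.restrict (integrable_const 1)]
        simp
    _ ≤ (∫ y, b (x - y)) + volume.real Ω := by
        gcongr
        · exact Eventually.of_forall fun y => hb0 _
        · exact Measure.restrict_le_self
    _ = ballConst + volume.real Ω := by
        rw [integral_sub_left_eq_self b volume x, hb, integral_indicator measurableSet_ball]
        rfl

/-- The bound for the Coulomb potential given by the inequality of arithmetic and geometric means
`|u| / r ≤ (u² + r⁻²) / 2`. -/
def potBound (Ω : Set E3) (u : E3 → ℝ) : ℝ :=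
  ((∫ y in Ω, u y ^ 2) + (ballConst + volume.real Ω)) / 2

theorem integrable_potential (hΩ : volume Ω ≠ ⊤) {u : E3 → ℝ}
    (hu : MemLp u 2 (volume.restrict Ω)) (x : E3) :
    Integrable (fun y => u y / ‖x - y‖) (volume.restrict Ω) ∧
      ∫ y in Ω, ‖u y / ‖x - y‖‖ ≤ potBound Ω u := by
  obtain ⟨h1, h2⟩ := integrable_kernel_sq hΩ x
  have hint := (hu.integrable_sq.add h1).div_const 2
  have hle : ∀ y, ‖u y / ‖x - y‖‖ ≤ (u y ^ 2 + (‖x - y‖ ^ 2)⁻¹) / 2 := by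
    intro y
    rw [norm_div, norm_norm, Real.norm_eq_abs, div_eq_mul_inv, ← sq_abs, ← inv_pow]
    nlinarith [sq_nonneg (|u y| - ‖x - y‖⁻¹)]
  have hm : Integrable (fun y => u y / ‖x - y‖) (volume.restrict Ω) :=
    hint.mono' (hu.1.div₀ (by fun_prop)) (Eventually.of_forall hle)
  refine ⟨hm, (integral_mono hm.norm hint hle).trans ?_⟩
  simp only [Pi.add_apply]
  rw [integral_div, integral_add hu.integrable_sq h1, potBound]
  gcongr

theorem abs_potential_le (hΩ : volume Ω ≠ ⊤) {u : E3 → ℝ}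
    (hu : MemLp u 2 (volume.restrict Ω)) (x : E3) : |potential Ω u x| ≤ potBound Ω u :=
  (norm_integral_le_integral_norm _).trans (integrable_potential hΩ hu x).2

theorem integrable_prod_kernel (hΩ : volume Ω ≠ ⊤) {u : E3 → ℝ}
    (hu : MemLp u 2 (volume.restrict Ω)) {μ : Measure E3} [SFinite μ] {f : E3 → ℝ}
    (hf : Integrable f μ) :
    Integrable (fun p : E3 × E3 => f p.1 * (u p.2 / ‖p.1 - p.2‖))
      (μ.prod (volume.restrict Ω)) := by
  have hm : AEStronglyMeasurable (fun p : E3 × E3 => f p.1 * (u p.2 / ‖p.1 - p.2‖))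
      (μ.prod (volume.restrict Ω)) :=
    hf.1.comp_fst.mul (hu.1.comp_snd.div₀ (by fun_prop))
  refine (integrable_prod_iff hm).2 ⟨Eventually.of_forall fun x =>
    (integrable_potential hΩ hu x).1.const_mul (f x), ?_⟩
  refine (hf.norm.mul_const (potBound Ω u)).mono' hm.norm.integral_prod_right'
    (Eventually.of_forall fun x => ?_)
  simp only [norm_mul (f _)]
  rw [integral_const_mul, norm_mul, norm_norm]
  gcongr
  refine le_trans (le_of_eq ?_) (integrable_potential hΩ hu x).2
  exact Real.norm_of_nonneg (integral_nonneg fun y => norm_nonneg _)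

theorem integrable_mul_potential (hΩ : volume Ω ≠ ⊤) {u : E3 → ℝ}
    (hu : MemLp u 2 (volume.restrict Ω)) {μ : Measure E3} [SFinite μ] {f : E3 → ℝ}
    (hf : Integrable f μ) : Integrable (fun x => f x * potential Ω u x) μ := by
  refine (integrable_prod_kernel hΩ hu hf).integral_prod_left.congr
    (Eventually.of_forall fun x => ?_)
  simp only [potential]
  rw [integral_const_mul]

/-- Fubini's theorem for the Coulomb kernel. -/
theorem integral_mul_potential (hΩ : volume Ω ≠ ⊤) {u : E3 → ℝ}
    (hu : MemLp u 2 (volume.restrict Ω)) {μ : Measure E3} [SFinite μ] {f : E3 → ℝ}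
    (hf : Integrable f μ) :
    ∫ x, f x * potential Ω u x ∂μ = ∫ y in Ω, u y * ∫ x, f x / ‖x - y‖ ∂μ := by
  have h := integral_integral_swap (f := fun x y => f x * (u y / ‖x - y‖))
    (integrable_prod_kernel hΩ hu hf)
  simp only [potential, ← integral_const_mul]
  rw [h]
  refine integral_congr_ae (Eventually.of_forall fun y => ?_)
  refine integral_congr_ae (Eventually.of_forall fun x => ?_)
  simp only
  ring

theorem coulomb_eq (Ω : Set E3) (φ ψ : E3 → ℝ) :
    coulomb Ω φ ψ = ∫ x in Ω, φ x * potential Ω ψ x := by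
  simp only [coulomb, potential, ← integral_const_mul, mul_div_assoc]

theorem coulomb_comm (hΩ : volume Ω ≠ ⊤) {u w : E3 → ℝ} (hu : MemLp u 2 (volume.restrict Ω))
    (hw : MemLp w 2 (volume.restrict Ω)) : coulomb Ω u w = coulomb Ω w u := by
  have : IsFiniteMeasure (volume.restrict Ω) := ⟨by simpa using hΩ.lt_top⟩
  rw [coulomb_eq, coulomb_eq, integral_mul_potential hΩ hw (hu.integrable (by norm_num))]
  refine integral_congr_ae (Eventually.of_forall fun y => ?_)
  simp only [potential, norm_sub_rev]

theorem integral_add₃ {μ : Measure E3} {f g h : E3 → ℝ} (hf : Integrable f μ)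
    (hg : Integrable g μ) (hh : Integrable h μ) :
    ∫ x, (f x + g x + h x) ∂μ = (∫ x, f x ∂μ) + (∫ x, g x ∂μ) + ∫ x, h x ∂μ := by
  rw [← integral_add hf hg]
  exact integral_add (hf.add hg) hh

theorem coulomb_linear (hΩ : volume Ω ≠ ⊤) {u w : E3 → ℝ} (hu : MemLp u 2 (volume.restrict Ω))
    (hw : MemLp w 2 (volume.restrict Ω)) (a b : ℝ) :
    coulomb Ω (fun x => a * u x + b * w x) (fun x => a * u x + b * w x) =
      a ^ 2 * coulomb Ω u u + 2 * a * b * coulomb Ω w u + b ^ 2 * coulomb Ω w w := by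
  have : IsFiniteMeasure (volume.restrict Ω) := ⟨by simpa using hΩ.lt_top⟩
  have hp : ∀ x, potential Ω (fun x => a * u x + b * w x) x =
      a * potential Ω u x + b * potential Ω w x := by
    intro x
    simp only [potential, ← integral_const_mul]
    rw [← integral_add ((integrable_potential hΩ hu x).1.const_mul a)
      ((integrable_potential hΩ hw x).1.const_mul b)]
    congr 1; ext y; ring
  have hu1 : Integrable u (volume.restrict Ω) := hu.integrable (by norm_num)
  have hw1 : Integrable w (volume.restrict Ω) := hw.integrable (by norm_num)
  have i1 := (integrable_mul_potential hΩ hu hu1).const_mul (a ^ 2)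
  have i2 := integrable_mul_potential hΩ hw hu1
  have i3 := integrable_mul_potential hΩ hu hw1
  have i4 := (integrable_mul_potential hΩ hw hw1).const_mul (b ^ 2)
  have e : ∀ x, (a * u x + b * w x) * potential Ω (fun x => a * u x + b * w x) x =
      a ^ 2 * (u x * potential Ω u x) +
        a * b * (u x * potential Ω w x + w x * potential Ω u x) +
        b ^ 2 * (w x * potential Ω w x) := by
    intro x; rw [hp]; ring
  rw [coulomb_eq]
  simp only [e]
  have i23 : Integrable (fun x => a * b * (u x * potential Ω w x + w x * potential Ω u x))
      (volume.restrict Ω) := (i2.add i3).const_mul (a * b)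
  rw [integral_add₃ i1 i23 i4]
  simp only [integral_const_mul]
  rw [integral_add i2 i3]
  simp only [← coulomb_eq]
  rw [coulomb_comm hΩ hu hw]
  ring

/-! ### The Euler–Lagrange equation -/

theorem integrable_inner_of_memLp {μ : Measure E3} {F G : E3 → E3} (hF : MemLp F 2 μ)
    (hG : MemLp G 2 μ) : Integrable (fun x => ⟪F x, G x⟫) μ := by
  refine (hF.norm.integrable_mul hG.norm).mono' (hF.1.inner hG.1) (Eventually.of_forall fun x => ?_)
  exact norm_inner_le_norm _ _

theorem dirichlet_linear {u w : E3 → ℝ} (hu : MemH1 u) (hw : MemH1 w) (a b : ℝ) :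
    dirichlet Ω (fun x => a * u x + b * w x) =
      a ^ 2 * dirichlet Ω u + 2 * a * b * (∫ x in Ω, ⟪weakGrad u x, weakGrad w x⟫) +
        b ^ 2 * dirichlet Ω w := by
  have hg := ae_restrict_of_ae (s := Ω)
    (hu.hasWeakGradient.linear hw.hasWeakGradient a b).weakGrad_ae_eq
  have hu2 := hu.memLp_weakGrad.restrict Ω
  have hw2 := hw.memLp_weakGrad.restrict Ω
  have i1 := (hu2.integrable_norm_pow (by simp)).const_mul (a ^ 2)
  have i2 : Integrable (fun x => 2 * a * b * ⟪weakGrad u x, weakGrad w x⟫) (volume.restrict Ω) :=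
    (integrable_inner_of_memLp hu2 hw2).const_mul (2 * a * b)
  have i3 := (hw2.integrable_norm_pow (by simp)).const_mul (b ^ 2)
  have e : (fun x => ‖weakGrad (fun x => a * u x + b * w x) x‖ ^ 2) =ᵐ[volume.restrict Ω]
      fun x => a ^ 2 * ‖weakGrad u x‖ ^ 2 + 2 * a * b * ⟪weakGrad u x, weakGrad w x⟫ +
        b ^ 2 * ‖weakGrad w x‖ ^ 2 := by
    filter_upwards [hg] with x hx
    rw [hx, norm_add_sq_real, norm_smul, norm_smul, mul_pow, mul_pow, inner_smul_left,
      inner_smul_right, Real.norm_eq_abs, Real.norm_eq_abs, sq_abs, sq_abs]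
    simp only [conj_trivial]
    ring
  rw [dirichlet, integral_congr_ae e, integral_add₃ i1 i2 i3]
  simp only [integral_const_mul, dirichlet]

theorem integral_sq_linear {u w : E3 → ℝ} (hu : MemLp u 2 (volume.restrict Ω))
    (hw : MemLp w 2 (volume.restrict Ω)) (a b : ℝ) :
    ∫ x in Ω, (a * u x + b * w x) ^ 2 =
      a ^ 2 * (∫ x in Ω, u x ^ 2) + 2 * a * b * (∫ x in Ω, u x * w x) +
        b ^ 2 * ∫ x in Ω, w x ^ 2 := by
  have i1 := hu.integrable_sq.const_mul (a ^ 2)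
  have i2 : Integrable (fun x => 2 * a * b * (u x * w x)) (volume.restrict Ω) :=
    (hu.integrable_mul hw).const_mul (2 * a * b)
  have i3 := hw.integrable_sq.const_mul (b ^ 2)
  rw [← integral_const_mul, ← integral_const_mul, ← integral_const_mul,
    ← integral_add₃ i1 i2 i3]
  congr 1; ext x; ring

theorem energy_linear (hΩ : volume Ω ≠ ⊤) (q : ℝ) {u w : E3 → ℝ} (hu : MemH1 u) (hw : MemH1 w)
    (a b : ℝ) :
    energy q Ω (fun x => a * u x + b * w x) =
      a ^ 2 * energy q Ω u + 2 * a * b * ((∫ x in Ω, ⟪weakGrad u x, weakGrad w x⟫) +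
        q / 2 * coulomb Ω w u) + b ^ 2 * energy q Ω w := by
  rw [energy, dirichlet_linear hu hw, coulomb_linear hΩ (hu.1.restrict Ω) (hw.1.restrict Ω),
    energy, energy]
  ring

/-- By homogeneity, `E_q(w, Ω) ≥ E_q(Ω) ∫_Ω w²` for all `w ∈ H¹₀(Ω)`. -/
theorem IsOptimal.energy_mul_le (hΩ : volume Ω ≠ ⊤) {q : ℝ} {u w : E3 → ℝ}
    (hu : IsOptimal q Ω u) (hw : MemH10 Ω w) :
    energy q Ω u * ∫ x in Ω, w x ^ 2 ≤ energy q Ω w := by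
  have hw2 := hw.1.1.restrict Ω
  have hn : 0 ≤ ∫ x in Ω, w x ^ 2 := integral_nonneg fun x => sq_nonneg _
  rcases hn.eq_or_lt with hn | hn
  · -- A function that vanishes on `Ω` has no Coulomb energy.
    have h0 := (integral_eq_zero_iff_of_nonneg (fun x => sq_nonneg _) hw2.integrable_sq).1 hn.symm
    have hc : coulomb Ω w w = 0 := by
      rw [coulomb_eq]
      refine integral_eq_zero_of_ae (h0.mono fun x hx => ?_)
      have : w x = 0 := by simpa using hx
      simp [this]
    rw [← hn, mul_zero, energy, hc, mul_zero, add_zero]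
    exact integral_nonneg fun x => by positivity
  · set n := ∫ x in Ω, w x ^ 2 with hndef
    have hs : (1 / √n) ^ 2 = 1 / n := by rw [div_pow, Real.sq_sqrt hn.le, one_pow]
    -- The normalization of `w`, written as a linear combination.
    have hadm : IsAdmissible Ω (fun x => 1 / √n * w x + 0 * w x) := by
      refine ⟨hw.linear hw _ _, ?_⟩
      rw [integral_sq_linear hw2 hw2, hs, ← hndef]
      field_simp
      ring
    have h1 : groundEnergy q Ω ≤ _ := iInf₂_le _ hadm
    rw [← hu.2, EReal.coe_le_coe_iff, energy_linear hΩ q hw.1 hw.1, hs] at h1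
    have h2 : energy q Ω u ≤ energy q Ω w / n := by
      refine h1.trans (le_of_eq ?_)
      ring
    rwa [le_div_iff₀ hn] at h2

/-- The energy inequality along `u + t φ` is a quadratic inequality in `t` with no constant term, so
its linear coefficient vanishes. -/
theorem IsOptimal.isWeakSolution (hΩ : volume Ω ≠ ⊤) {q : ℝ} {u : E3 → ℝ}
    (hu : IsOptimal q Ω u) :
    IsWeakSolution Ω (energy q Ω u) (fun x => -(q / 2) * potential Ω u x) u := by
  refine ⟨hu.1.1, fun φ hφ => ?_⟩
  have hu1 := hu.1.1.1
  set A := ∫ x in Ω, ⟪weakGrad u x, weakGrad φ x⟫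
  set M := ∫ x in Ω, u x * φ x
  set μ := energy q Ω u with hμ
  have key : ∀ t : ℝ, 0 ≤ (energy q Ω φ - μ * ∫ x in Ω, φ x ^ 2) * (t * t) +
      2 * (A + q / 2 * coulomb Ω φ u - μ * M) * t + 0 := by
    intro t
    have h := hu.energy_mul_le hΩ (hu.1.1.linear hφ 1 t)
    rw [energy_linear hΩ q hu1 hφ.1, integral_sq_linear (hu1.1.restrict Ω) (hφ.1.1.restrict Ω),
      hu.1.2, ← hμ] at h
    linear_combination h
  have hd := discrim_le_zero key
  -- The discriminant is the square of twice the linear coefficient.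
  have h0 : A + q / 2 * coulomb Ω φ u - μ * M = 0 := by
    rw [discrim] at hd
    nlinarith [sq_nonneg (A + q / 2 * coulomb Ω φ u - μ * M)]
  have e : ∫ x in Ω, -(q / 2) * potential Ω u x * φ x = -(q / 2) * coulomb Ω φ u := by
    rw [coulomb_eq, ← integral_const_mul]
    congr 1; ext x; ring
  rw [e]
  linarith

end

/-! ### Powers of the distance and their Laplacians -/

/-- The regularized power `(|y|² + a)ᵗ` of the distance to the origin; for `a = 0` it is
`|y|²ᵗ`. -/
def rad (a t : ℝ) (y : E3) : ℝ := (‖y‖ ^ 2 + a) ^ t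

theorem hasFDerivAt_rad {a : ℝ} (t : ℝ) {y : E3} (hy : 0 < ‖y‖ ^ 2 + a) :
    HasFDerivAt (rad a t) ((t * (‖y‖ ^ 2 + a) ^ (t - 1)) • (2 • innerSL ℝ y)) y :=
  (((hasStrictFDerivAt_norm_sq y).hasFDerivAt).add_const a).rpow_const (Or.inl hy.ne')

theorem pd_rad {a : ℝ} (t : ℝ) {y : E3} (hy : 0 < ‖y‖ ^ 2 + a) (i : Fin 3) :
    pd i (rad a t) y = 2 * t * y i * rad a (t - 1) y := by
  rw [pd, (hasFDerivAt_rad t hy).fderiv]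
  simp [rad, EuclideanSpace.inner_single_right]
  ring

theorem pd_congr {f g : E3 → ℝ} {y : E3} (h : f =ᶠ[𝓝 y] g) (i : Fin 3) :
    pd i f =ᶠ[𝓝 y] pd i g :=
  (h.fderiv (𝕜 := ℝ)).mono fun z hz => by simp only [pd, hz]

theorem lap_congr {f g : E3 → ℝ} {y : E3} (h : f =ᶠ[𝓝 y] g) : lap f y = lap g y :=
  Finset.sum_congr rfl fun i _ => (pd_congr (pd_congr h i) i).self_of_nhds

theorem eventually_rad_pos {a : ℝ} {y : E3} (hy : 0 < ‖y‖ ^ 2 + a) :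
    ∀ᶠ z : E3 in 𝓝 y, 0 < ‖z‖ ^ 2 + a :=
  (Continuous.continuousAt (by fun_prop : Continuous fun z : E3 => ‖z‖ ^ 2 + a)).eventually
    (lt_mem_nhds hy)

theorem hasFDerivAt_coord (i : Fin 3) (y : E3) :
    HasFDerivAt (fun z : E3 => z i) (EuclideanSpace.proj i : E3 →L[ℝ] ℝ) y :=
  (EuclideanSpace.proj i : E3 →L[ℝ] ℝ).hasFDerivAt

theorem lap_const_mul (c : ℝ) (f : E3 → ℝ) (y : E3) :
    lap (fun z => c * f z) y = c * lap f y := by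
  have h : ∀ i (f : E3 → ℝ), pd i (fun z => c * f z) = fun z => c * pd i f z := by
    intro i f
    ext z
    have e : (fun z => c * f z) = c • f := rfl
    simp only [pd]
    rw [e, fderiv_const_smul_field]
    rfl
  simp only [lap, h, Finset.mul_sum]

/-- For `a = 0` and `t = -1/2` the right-hand side vanishes: `1 / |y|` is harmonic away from the
origin. -/
theorem lap_rad {a : ℝ} (t : ℝ) {y : E3} (hy : 0 < ‖y‖ ^ 2 + a) :
    lap (rad a t) y = 2 * t * (2 * t + 1) * rad a (t - 1) y +
      4 * t * (1 - t) * (a * rad a (t - 2) y) := by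
  have h1 : ∀ i, pd i (pd i (rad a t)) y =
      2 * t * rad a (t - 1) y + 4 * t * (t - 1) * (y i ^ 2) * rad a (t - 2) y := by
    intro i
    have e : pd i (rad a t) =ᶠ[𝓝 y] fun z => (2 * t * z i) * rad a (t - 1) z :=
      (eventually_rad_pos hy).mono fun z hz => pd_rad t hz i
    rw [(pd_congr e i).self_of_nhds,
      pd_mul ((hasFDerivAt_coord i y).const_mul (2 * t)).differentiableAt
      (hasFDerivAt_rad (t - 1) hy).differentiableAt, pd_rad (t - 1) hy, pd,
      ((hasFDerivAt_coord i y).const_mul (2 * t)).fderiv]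
    have : t - 1 - 1 = t - 2 := by ring
    rw [this]
    simp
    ring
  have h2 : rad a (t - 1) y = rad a (t - 2) y * (‖y‖ ^ 2 + a) := by
    rw [rad, rad, ← Real.rpow_add_one hy.ne']
    congr 1; ring
  have h3 : ‖y‖ ^ 2 = y 0 ^ 2 + y 1 ^ 2 + y 2 ^ 2 := by
    rw [EuclideanSpace.real_norm_sq_eq, Fin.sum_univ_three]
  rw [lap, Fin.sum_univ_three, h1, h1, h1, h2, h3]
  ring

theorem contDiff_rad {a : ℝ} (ha : 0 < a) (t : ℝ) : ContDiff ℝ ∞ (rad a t) :=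
  ((contDiff_norm_sq ℝ).add contDiff_const).rpow_const_of_ne fun y => by positivity

theorem rad_nonneg {a : ℝ} (ha : 0 ≤ a) (t : ℝ) (y : E3) : 0 ≤ rad a t y :=
  Real.rpow_nonneg (by positivity) t

theorem rad_zero_neg_half (y : E3) : rad 0 (-1 / 2) y = ‖y‖⁻¹ := by
  rw [rad, add_zero, neg_div, Real.rpow_neg (by positivity), ← Real.sqrt_eq_rpow,
    Real.sqrt_sq (norm_nonneg y)]

/-- A locally integrable bound for `(|y|² + a)ᵗ`, uniform in `a ∈ [0, 1]`. -/
theorem rad_le {a t : ℝ} (ht : -1 / 2 ≤ t) (ha : 0 ≤ a) (ha1 : a ≤ 1) {y : E3} (hy : y ≠ 0) :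
    rad a t y ≤ rad 1 (t + 1 / 2) y * ‖y‖⁻¹ := by
  have h0 : 0 < ‖y‖ := norm_pos_iff.2 hy
  have h1 : rad a t y = rad a (t + 1 / 2) y * rad a (-1 / 2) y := by
    rw [rad, rad, rad, ← Real.rpow_add (by positivity)]
    congr 1; ring
  rw [h1, ← rad_zero_neg_half]
  have h2 : rad a (t + 1 / 2) y ≤ rad 1 (t + 1 / 2) y :=
    Real.rpow_le_rpow (by positivity) (by linarith) (by linarith)
  have h3 : rad a (-1 / 2) y ≤ rad 0 (-1 / 2) y :=
    Real.rpow_le_rpow_of_nonpos (by positivity) (by linarith) (by norm_num)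
  exact mul_le_mul h2 h3 (rad_nonneg ha _ y) (rad_nonneg zero_le_one _ y)

theorem locallyIntegrable_norm_inv : LocallyIntegrable fun y : E3 => ‖y‖⁻¹ := by
  simpa using locallyIntegrable_norm_inv_pow (k := 1) (by norm_num)

theorem measurable_rad (a t : ℝ) : Measurable (rad a t) :=
  (by fun_prop : Measurable fun y : E3 => ‖y‖ ^ 2 + a).pow_const t

theorem ae_ne_zero : ∀ᵐ y : E3, y ≠ 0 := by
  rw [ae_iff]; simp

theorem integrable_rad_bound (t : ℝ) {g : E3 → ℝ} (hg : IsTest g) :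
    Integrable fun y => rad 1 (t + 1 / 2) y * ‖y‖⁻¹ * ‖g y‖ := by
  have h := (hg.mul_left (contDiff_rad one_pos (t + 1 / 2))).integrable_mul
    locallyIntegrable_norm_inv
  refine h.norm.congr (Eventually.of_forall fun y => ?_)
  simp only [norm_mul, norm_inv, norm_norm, Real.norm_of_nonneg (rad_nonneg zero_le_one _ y)]
  ring

theorem tendsto_rad {t : ℝ} {y : E3} (hy : y ≠ 0) {a : ℕ → ℝ} (ha : Tendsto a atTop (𝓝 0)) :
    Tendsto (fun n => rad (a n) t y) atTop (𝓝 (rad 0 t y)) := by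
  have h0 : ‖y‖ ^ 2 + 0 ≠ 0 := by simpa using hy
  exact (tendsto_const_nhds.add ha).rpow_const (Or.inl h0)

theorem tendsto_integral_rad {t : ℝ} (ht : -1 / 2 ≤ t) {g : E3 → ℝ} (hg : IsTest g) {a : ℕ → ℝ}
    (ha0 : ∀ n, 0 ≤ a n) (ha1 : ∀ n, a n ≤ 1) (ha : Tendsto a atTop (𝓝 0)) :
    Tendsto (fun n => ∫ y, rad (a n) t y * g y) atTop (𝓝 (∫ y, rad 0 t y * g y)) := by
  refine tendsto_integral_of_dominated_convergence _
    (fun n => (measurable_rad _ _).aestronglyMeasurable.mul hg.continuous.aestronglyMeasurable)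
    (integrable_rad_bound t hg) (fun n => ae_ne_zero.mono fun y hy => ?_)
    (ae_ne_zero.mono fun y hy => (tendsto_rad hy ha).mul_const _)
  rw [norm_mul, Real.norm_of_nonneg (rad_nonneg (ha0 n) _ y)]
  gcongr
  exact rad_le ht (ha0 n) (ha1 n) hy

/-- The error term of the regularization in `lap_rad` disappears in the limit, because
`a (|y|² + a)ᵗ⁻¹ ≤ (|y|² + a)ᵗ`. -/
theorem tendsto_integral_rad_error {t : ℝ} (ht : -1 / 2 ≤ t) {g : E3 → ℝ} (hg : IsTest g)
    {a : ℕ → ℝ} (ha0 : ∀ n, 0 ≤ a n) (ha1 : ∀ n, a n ≤ 1) (ha : Tendsto a atTop (𝓝 0)) :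
    Tendsto (fun n => ∫ y, a n * rad (a n) (t - 1) y * g y) atTop (𝓝 0) := by
  rw [← integral_zero E3 ℝ (μ := volume)]
  refine tendsto_integral_of_dominated_convergence _
    (fun n => ((measurable_rad _ _).const_mul _).aestronglyMeasurable.mul
      hg.continuous.aestronglyMeasurable)
    (integrable_rad_bound t hg) (fun n => ae_ne_zero.mono fun y hy => ?_)
    (ae_ne_zero.mono fun y hy => ?_)
  · have h0 : 0 < ‖y‖ := norm_pos_iff.2 hy
    have hp : 0 < ‖y‖ ^ 2 + a n := by have := ha0 n; positivity
    rw [norm_mul, Real.norm_of_nonneg (mul_nonneg (ha0 n) (rad_nonneg (ha0 n) _ y))]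
    refine mul_le_mul_of_nonneg_right ?_ (norm_nonneg _)
    refine le_trans ?_ (rad_le ht (ha0 n) (ha1 n) hy)
    have : rad (a n) t y = (‖y‖ ^ 2 + a n) * rad (a n) (t - 1) y := by
      rw [rad, rad, mul_comm, ← Real.rpow_add_one hp.ne']
      congr 1; ring
    rw [this]
    exact mul_le_mul_of_nonneg_right (by nlinarith) (rad_nonneg (ha0 n) _ y)
  · have := (ha.mul (tendsto_rad (t := t - 1) hy ha)).mul_const (g y)
    simpa using this

/-- `Δ |y|²ᵗ = 2t (2t + 1) |y|²ᵗ⁻²` in the sense of distributions, for `2t ≥ 1`. -/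
theorem integral_rad_mul_lap {t : ℝ} (ht : 1 / 2 ≤ t) {g : E3 → ℝ} (hg : IsTest g) :
    ∫ y, rad 0 t y * lap g y = 2 * t * (2 * t + 1) * ∫ y, rad 0 (t - 1) y * g y := by
  set a : ℕ → ℝ := fun n => 1 / ((n : ℝ) + 1) with hadef
  have ha0 : ∀ n, 0 < a n := fun n => by positivity
  have ha1 : ∀ n, a n ≤ 1 := fun n => by
    rw [hadef]
    exact (div_le_one (by positivity)).2 (by linarith [n.cast_nonneg (α := ℝ)])
  have ha : Tendsto a atTop (𝓝 0) := tendsto_one_div_add_atTop_nhds_zero_nat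
  have l1 := tendsto_integral_rad (t := t) (by linarith) hg.lap (fun n => (ha0 n).le) ha1 ha
  have l2 := tendsto_integral_rad (t := t - 1) (by linarith) hg (fun n => (ha0 n).le) ha1 ha
  have l3 := tendsto_integral_rad_error (t := t - 1) (by linarith) hg (fun n => (ha0 n).le) ha1 ha
  have e : ∀ n, ∫ y, rad (a n) t y * lap g y =
      2 * t * (2 * t + 1) * (∫ y, rad (a n) (t - 1) y * g y) +
        4 * t * (1 - t) * ∫ y, a n * rad (a n) (t - 1 - 1) y * g y := by
    intro n
    have i1 := hg.integrable_mul (contDiff_rad (ha0 n) (t - 1)).continuous.locallyIntegrable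
    have i2 := hg.integrable_mul (f := fun y => a n * rad (a n) (t - 1 - 1) y)
      (contDiff_const.mul (contDiff_rad (ha0 n) (t - 1 - 1))).continuous.locallyIntegrable
    rw [integral_mul_lap (contDiff_rad (ha0 n) t) hg, ← integral_const_mul, ← integral_const_mul,
      ← integral_add (i1.const_mul _) (i2.const_mul _)]
    congr 1
    ext y
    rw [lap_rad t (by have := ha0 n; positivity), show t - 1 - 1 = t - 2 by ring]
    ring
  have l4 := ((l2.const_mul (2 * t * (2 * t + 1))).add (l3.const_mul (4 * t * (1 - t)))).congr
    fun n => (e n).symm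
  rw [mul_zero, add_zero] at l4
  exact tendsto_nhds_unique l1 l4

/-- The total mass of the density `-Δ (|y|² + 1)^(-1/2) = 3 (|y|² + 1)^(-5/2)` (it equals `4π`). -/
def newtonConst : ℝ := ∫ y : E3, 3 * rad 1 (-5 / 2) y

theorem integrable_rad_five_half : Integrable (rad 1 (-5 / 2)) := by
  have := integrable_rpow_neg_one_add_norm_sq (E := E3) (μ := volume) (r := 5) (by simp; norm_num)
  refine this.congr (Eventually.of_forall fun y => ?_)
  simp only [rad]
  rw [add_comm]

theorem newtonConst_pos : 0 < newtonConst := by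
  have h : ∀ y : E3, 0 < 3 * rad 1 (-5 / 2) y := fun y =>
    mul_pos (by norm_num) (Real.rpow_pos_of_pos (by positivity) _)
  rw [newtonConst, integral_pos_iff_support_of_nonneg (fun y => (h y).le)
    (integrable_rad_five_half.const_mul 3)]
  have : Function.support (fun y : E3 => 3 * rad 1 (-5 / 2) y) = univ :=
    eq_univ_of_forall fun y => (h y).ne'
  rw [this]
  simp

/-- `-Δ (1 / |y|)` is a positive multiple of the Dirac mass at the origin. -/
theorem integral_norm_inv_mul_lap {g : E3 → ℝ} (hg : IsTest g) :
    ∫ y, rad 0 (-1 / 2) y * lap g y = -newtonConst * g 0 := by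
  set b : ℕ → ℝ := fun n => 1 / ((n : ℝ) + 1) with hbdef
  have hb0 : ∀ n, 0 < b n := fun n => by positivity
  have hb1 : ∀ n, b n ≤ 1 := fun n => by
    rw [hbdef]
    exact (div_le_one (by positivity)).2 (by linarith [n.cast_nonneg (α := ℝ)])
  have hb : Tendsto b atTop (𝓝 0) := tendsto_one_div_add_atTop_nhds_zero_nat
  set a : ℕ → ℝ := fun n => b n ^ 2 with hadef
  have ha0 : ∀ n, 0 < a n := fun n => pow_pos (hb0 n) 2
  have ha1 : ∀ n, a n ≤ 1 := fun n => pow_le_one₀ (hb0 n).le (hb1 n)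
  have ha : Tendsto a atTop (𝓝 0) := by simpa using hb.pow 2
  have l1 := tendsto_integral_rad (t := -1 / 2) le_rfl hg.lap (fun n => (ha0 n).le) ha1 ha
  -- Rescaling `y = bₙ z` turns the regularized Dirac masses into a fixed density.
  have e : ∀ n, ∫ y, rad (a n) (-1 / 2) y * lap g y =
      - ∫ z, 3 * rad 1 (-5 / 2) z * g (b n • z) := by
    intro n
    have hbn := hb0 n
    rw [integral_mul_lap (contDiff_rad (ha0 n) _) hg]
    have h1 : ∀ y : E3, lap (rad (a n) (-1 / 2)) y * g y =
        - ((b n ^ 3)⁻¹ * (fun z => 3 * rad 1 (-5 / 2) z * g (b n • z)) ((b n)⁻¹ • y)) := by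
      intro y
      rw [lap_rad _ (by have := ha0 n; positivity)]
      have h2 : rad (a n) (-1 / 2 - 2) y = (b n ^ 5)⁻¹ * rad 1 (-5 / 2) ((b n)⁻¹ • y) := by
        have h3 : ‖y‖ ^ 2 + a n = b n ^ 2 * (‖(b n)⁻¹ • y‖ ^ 2 + 1) := by
          rw [norm_smul, norm_inv, Real.norm_of_nonneg hbn.le, hadef]
          field_simp
        have h4 : (b n ^ 2) ^ ((-1 : ℝ) / 2 - 2) = (b n ^ 5)⁻¹ := by
          rw [← Real.rpow_natCast (b n) 2, ← Real.rpow_mul hbn.le, ← Real.rpow_natCast (b n) 5,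
            ← Real.rpow_neg hbn.le]
          norm_num
        rw [rad, rad, h3, Real.mul_rpow (by positivity) (by positivity), h4]
        norm_num
      rw [h2]
      simp only [smul_inv_smul₀ hbn.ne', hadef]
      field_simp
      ring
    have h5 := Measure.integral_comp_inv_smul_of_nonneg volume
      (fun z => 3 * rad 1 (-5 / 2) z * g (b n • z)) hbn.le
    rw [integral_congr_ae (Eventually.of_forall h1), integral_neg, integral_const_mul, h5]
    simp only [finrank_euclideanSpace, Fintype.card_fin, smul_eq_mul]
    rw [← mul_assoc, inv_mul_cancel₀ (by positivity), one_mul]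
  have l2 : Tendsto (fun n => ∫ z, 3 * rad 1 (-5 / 2) z * g (b n • z)) atTop
      (𝓝 (∫ z, 3 * rad 1 (-5 / 2) z * g 0)) := by
    obtain ⟨M, hM0, hM⟩ := hg.exists_bound
    refine tendsto_integral_of_dominated_convergence (fun z => 3 * rad 1 (-5 / 2) z * M)
      (fun n => ?_) ((integrable_rad_five_half.const_mul 3).mul_const M)
      (fun n => Eventually.of_forall fun z => ?_) (Eventually.of_forall fun z => ?_)
    · exact ((measurable_rad _ _).const_mul 3).aestronglyMeasurable.mul
        (hg.continuous.comp (continuous_const_smul _)).aestronglyMeasurable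
    · have := rad_nonneg zero_le_one (-5 / 2) z
      rw [norm_mul, Real.norm_of_nonneg (by positivity)]
      gcongr
      exact hM _
    · have h := (hg.continuous.tendsto _).comp (hb.smul_const z)
      rw [zero_smul] at h
      exact h.const_mul _
  rw [integral_mul_const] at l2
  have := tendsto_nhds_unique l1 (l2.neg.congr fun n => (e n).symm)
  rw [this, newtonConst, neg_mul]

/-! ### Fundamental solutions of the powers of the Laplacian -/

section

theorem IsTest.iterate_lap {φ : E3 → ℝ} (h : IsTest φ) (k : ℕ) :
    IsTest (CoulombShape.lap^[k] φ) := by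
  induction k generalizing φ with
  | zero => exact h
  | succ k ih => exact ih h.lap

theorem contDiff_iterate_lap {f : E3 → ℝ} (h : ContDiff ℝ ∞ f) (k : ℕ) :
    ContDiff ℝ ∞ (lap^[k] f) := by
  induction k generalizing f with
  | zero => exact h
  | succ k ih => exact ih (ContDiff.lap h)

theorem integral_mul_iterate_lap {f g : E3 → ℝ} (hf : ContDiff ℝ ∞ f) (hg : IsTest g) (k : ℕ) :
    ∫ x, f x * (lap^[k] g) x = ∫ x, (lap^[k] f) x * g x := by
  induction k generalizing f with
  | zero => rfl
  | succ k ih =>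
    rw [Function.iterate_succ_apply', integral_mul_lap hf (hg.iterate_lap k), ih (ContDiff.lap hf),
      Function.iterate_succ_apply]

theorem iterate_lap_sub_left (f : E3 → ℝ) (x : E3) (k : ℕ) :
    lap^[k] (fun z => f (x - z)) = fun y => (lap^[k] f) (x - y) := by
  induction k generalizing f with
  | zero => rfl
  | succ k ih => rw [Function.iterate_succ_apply, lap_sub_left, ih, Function.iterate_succ_apply]

/-- The constants `cₘ` in `Δᵐ⁺¹ |y|²ᵐ⁻¹ = cₘ δ₀`. -/
def polyConst : ℕ → ℝ
  | 0 => -newtonConst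
  | m + 1 => 2 * (m + 1 / 2) * (2 * (m + 1 / 2) + 1) * polyConst m

theorem polyConst_ne_zero (m : ℕ) : polyConst m ≠ 0 := by
  induction m with
  | zero => exact neg_ne_zero.2 newtonConst_pos.ne'
  | succ m ih => exact mul_ne_zero (by positivity) ih

/-- `Δᵐ⁺¹ |y|²ᵐ⁻¹ = cₘ δ₀` in the sense of distributions. -/
theorem integral_rad_mul_iterate_lap (m : ℕ) {g : E3 → ℝ} (hg : IsTest g) :
    ∫ y, rad 0 (m - 1 / 2) y * (lap^[m + 1] g) y = polyConst m * g 0 := by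
  induction m with
  | zero =>
    have := integral_norm_inv_mul_lap hg
    simpa [polyConst, neg_div] using this
  | succ m ih =>
    have e : ((m + 1 : ℕ) : ℝ) - 1 / 2 = m + 1 / 2 := by push_cast; ring
    rw [Function.iterate_succ_apply', e,
      integral_rad_mul_lap (by linarith [m.cast_nonneg (α := ℝ)]) (hg.iterate_lap (m + 1)),
      show (m : ℝ) + 1 / 2 - 1 = m - 1 / 2 by ring, ih, polyConst]
    ring

/-- A multiple of `|y|²ᵐ⁻¹` is annihilated by `Δᵐ⁺¹` away from the origin. -/
theorem iterate_lap_rad_eq_zero (m : ℕ) {O : Set E3} (hO : IsOpen O) (h0 : (0 : E3) ∉ O)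
    {f : E3 → ℝ} {c : ℝ} (hf : ∀ y ∈ O, f y = c * rad 0 (m - 1 / 2) y) :
    ∀ y ∈ O, (lap^[m + 1] f) y = 0 := by
  have hpos : ∀ y ∈ O, 0 < ‖y‖ ^ 2 + (0 : ℝ) := fun y hy => by
    have : y ≠ 0 := fun h => h0 (h ▸ hy)
    positivity
  have hlap : ∀ (t : ℝ) (f : E3 → ℝ) (c : ℝ), (∀ y ∈ O, f y = c * rad 0 t y) →
      ∀ y ∈ O, lap f y = c * (2 * t * (2 * t + 1)) * rad 0 (t - 1) y := by
    intro t f c hf y hy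
    have e : f =ᶠ[𝓝 y] fun z => c * rad 0 t z := (hO.eventually_mem hy).mono hf
    rw [lap_congr e, lap_const_mul, lap_rad t (hpos y hy)]
    ring
  induction m generalizing f c with
  | zero =>
    intro y hy
    simp only [zero_add, Function.iterate_one]
    rw [hlap _ f c hf y hy]
    norm_num
  | succ m ih =>
    intro y hy
    rw [Function.iterate_succ_apply]
    set t : ℝ := ((m + 1 : ℕ) : ℝ) - 1 / 2 with ht
    refine ih (c := c * (2 * t * (2 * t + 1))) (fun z hz => ?_) y hy
    rw [hlap _ f c hf z hz, show t - 1 = m - 1 / 2 by rw [ht]; push_cast; ring]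

theorem rad_zero_eq (t : ℝ) (y : E3) : rad 0 t y = ‖y‖ ^ (2 * t) := by
  rw [rad, add_zero, ← Real.rpow_natCast, ← Real.rpow_mul (norm_nonneg y)]
  norm_num

/-- Odd powers of the distance become arbitrarily smooth at the origin. -/
theorem contDiff_rad_zero (k : ℕ) : ContDiff ℝ k (rad 0 (k + 1 / 2)) := by
  have key : ∀ k : ℕ, ContDiff ℝ k fun y : E3 => ‖y‖ ^ (2 * (k : ℝ) + 1) := by
    intro k
    induction k with
    | zero =>
      have h : ContDiff ℝ 0 fun y : E3 => ‖y‖ := contDiff_zero.2 continuous_norm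
      simpa using h
    | succ k ih =>
      have hp : 1 < 2 * ((k + 1 : ℕ) : ℝ) + 1 := by
        push_cast; linarith [k.cast_nonneg (α := ℝ)]
      rw [show ((k + 1 : ℕ) : WithTop ℕ∞) = (k : WithTop ℕ∞) + 1 by push_cast; rfl,
        contDiff_succ_iff_fderiv (𝕜 := ℝ)]
      refine ⟨differentiable_norm_rpow hp, by simp, ?_⟩
      have e : fderiv ℝ (fun y : E3 => ‖y‖ ^ (2 * ((k + 1 : ℕ) : ℝ) + 1)) = fun y =>
          ((2 * ((k + 1 : ℕ) : ℝ) + 1) * ‖y‖ ^ (2 * (k : ℝ) + 1)) • innerSL ℝ y := by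
        ext1 y
        rw [fderiv_norm_rpow y hp]
        congr 3
        push_cast
        ring
      rw [e]
      exact (contDiff_const.mul ih).smul (innerSL ℝ).contDiff
  have e : rad 0 (k + 1 / 2) = fun y : E3 => ‖y‖ ^ (2 * (k : ℝ) + 1) := by
    ext y
    rw [rad_zero_eq]
    congr 1
    ring
  rw [e]
  exact key k

/-! ### Convolution with a compactly supported kernel -/

/-- The convolution `k ⋆ g`. -/
def cv (k g : E3 → ℝ) (x : E3) : ℝ := ∫ y, k y * g (x - y)

theorem cv_eq_swap (k g : E3 → ℝ) (x : E3) : cv k g x = ∫ z, k (x - z) * g z := by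
  rw [cv, ← integral_sub_left_eq_self _ volume x]
  simp

variable {k g w : E3 → ℝ}

theorem IsTest.cv (hg : IsTest g) (hk : LocallyIntegrable k) (hks : HasCompactSupport k) :
    IsTest (cv k g) :=
  ⟨hg.supp.contDiff_convolution_right (ContinuousLinearMap.lsmul ℝ ℝ) hk hg.smooth,
    hks.convolution (ContinuousLinearMap.lsmul ℝ ℝ) hg.supp⟩

theorem pd_cv (hg : IsTest g) (hk : LocallyIntegrable k) (i : Fin 3) :
    pd i (cv k g) = cv k (pd i g) := by
  ext x
  have h := hg.supp.hasFDerivAt_convolution_right (μ := volume) (ContinuousLinearMap.lsmul ℝ ℝ) hk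
    (hg.smooth.of_le (by simp)) x
  change fderiv ℝ (k ⋆[ContinuousLinearMap.lsmul ℝ ℝ, volume] g) x _ = _
  rw [h.fderiv, convolution_precompR_apply _ hk (hg.supp.fderiv ℝ)
    (hg.smooth.continuous_fderiv (by simp))]
  rfl

theorem lap_cv (hg : IsTest g) (hk : LocallyIntegrable k) :
    lap (cv k g) = cv k (lap g) := by
  ext x
  simp only [lap, cv, Finset.mul_sum]
  rw [integral_finsetSum]
  · refine Finset.sum_congr rfl fun i _ => ?_
    have e : pd i (pd i (CoulombShape.cv k g)) = CoulombShape.cv k (pd i (pd i g)) := by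
      rw [pd_cv hg hk, pd_cv (hg.pd i) hk]
    exact congrFun e x
  · exact fun i _ => (((hg.pd i).pd i).sub_left x).integrable_mul hk

theorem iterate_lap_cv (hg : IsTest g) (hk : LocallyIntegrable k) (m : ℕ) :
    lap^[m] (cv k g) = cv k (lap^[m] g) := by
  induction m generalizing g with
  | zero => rfl
  | succ m ih => rw [Function.iterate_succ_apply, lap_cv hg hk, ih hg.lap,
      Function.iterate_succ_apply]

theorem integrable_prod_cv (hw : LocallyIntegrable w) (hk : Integrable k)
    (hks : HasCompactSupport k) (hg : IsTest g) :
    Integrable (fun p : E3 × E3 => w p.1 * k (p.1 - p.2) * g p.2) (volume.prod volume) := by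
  set Kc : Set E3 := tsupport k + tsupport g with hKc
  have hKcc : IsCompact Kc := hks.isCompact.add hg.supp.isCompact
  have hw1 : Integrable (Kc.indicator w) :=
    (integrable_indicator_iff hKcc.measurableSet).2 (hw.integrableOn_isCompact hKcc)
  have h1 := (hw1.convolution_integrand (ContinuousLinearMap.lsmul ℝ ℝ) hk.comp_neg).swap
  obtain ⟨M, hM0, hM⟩ := hg.exists_bound
  have h2 : Integrable (fun p : E3 × E3 => Kc.indicator w p.1 * k (p.1 - p.2))
      (volume.prod volume) := by
    refine h1.congr (Eventually.of_forall fun p => ?_)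
    simp
  have h3 : Integrable (fun p : E3 × E3 => Kc.indicator w p.1 * k (p.1 - p.2) * g p.2)
      (volume.prod volume) := by
    refine (h2.norm.mul_const M).mono'
      (h2.1.mul (hg.continuous.comp continuous_snd).aestronglyMeasurable)
      (Eventually.of_forall fun p => ?_)
    rw [norm_mul]
    gcongr
    exact hM _
  refine h3.congr (Eventually.of_forall fun p => ?_)
  simp only
  by_cases hp : p.1 ∈ Kc
  · rw [indicator_of_mem hp]
  · have : k (p.1 - p.2) = 0 ∨ g p.2 = 0 := by
      by_contra h
      rw [not_or] at h
      refine hp ⟨p.1 - p.2, subset_tsupport _ h.1, p.2, subset_tsupport _ h.2, ?_⟩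
      simp
    rcases this with h | h <;> simp [h]

/-- The adjoint of the convolution by `k` is the convolution by the reflected kernel. -/
theorem integral_mul_cv (hw : LocallyIntegrable w) (hk : Integrable k)
    (hks : HasCompactSupport k) (hg : IsTest g) :
    Integrable (fun z => (∫ x, w x * k (x - z)) * g z) ∧
      ∫ x, w x * cv k g x = ∫ z, (∫ x, w x * k (x - z)) * g z := by
  have h := integrable_prod_cv hw hk hks hg
  refine ⟨h.integral_prod_right.congr (Eventually.of_forall fun z => ?_), ?_⟩
  · exact integral_mul_const (g z) (fun x => w x * k (x - z))
  · have h2 := integral_integral_swap (f := fun x z => w x * k (x - z) * g z) h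
    simp only [integral_mul_const] at h2
    rw [← h2]
    refine integral_congr_ae (Eventually.of_forall fun x => ?_)
    simp only [cv_eq_swap, ← integral_const_mul, mul_assoc]

/-! ### Parametrices -/

/-- The truncated fundamental solution `η |y|²ᵐ⁻¹`. -/
def trunc (η : ContDiffBump (0 : E3)) (m : ℕ) (y : E3) : ℝ := η y * rad 0 (m - 1 / 2) y

theorem locallyIntegrable_rad {t : ℝ} (ht : -1 / 2 ≤ t) : LocallyIntegrable (rad 0 t) := by
  have h : LocallyIntegrable fun y : E3 => rad 1 (t + 1 / 2) y * ‖y‖⁻¹ := by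
    have h0 := locallyIntegrable_norm_inv
    rw [locallyIntegrable_iff] at h0 ⊢
    exact fun K hK => (h0 K hK).continuousOn_mul
      (contDiff_rad one_pos (t + 1 / 2)).continuous.continuousOn hK
  intro x
  refine (h x).imp fun s hs => ⟨hs.1, hs.2.mono' (measurable_rad 0 t).aestronglyMeasurable
    (ae_restrict_of_ae (ae_ne_zero.mono fun y hy => ?_))⟩
  rw [Real.norm_of_nonneg (rad_nonneg le_rfl t y)]
  exact rad_le ht le_rfl zero_le_one hy

theorem hasCompactSupport_trunc (η : ContDiffBump (0 : E3)) (m : ℕ) :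
    HasCompactSupport (trunc η m) := η.hasCompactSupport.mul_right

theorem isTest_contDiffBump (η : ContDiffBump (0 : E3)) : IsTest η :=
  ⟨η.contDiff, η.hasCompactSupport⟩

theorem integrable_trunc (η : ContDiffBump (0 : E3)) (m : ℕ) : Integrable (trunc η m) := by
  have := (isTest_contDiffBump η).integrable_mul (locallyIntegrable_rad (t := m - 1 / 2)
    (by linarith [m.cast_nonneg (α := ℝ)]))
  exact this.congr (Eventually.of_forall fun y => mul_comm _ _)

theorem contDiff_trunc (η : ContDiffBump (0 : E3)) (m : ℕ) : ContDiff ℝ m (trunc η (m + 1)) := by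
  have e : ((m + 1 : ℕ) : ℝ) - 1 / 2 = m + 1 / 2 := by push_cast; ring
  unfold trunc
  rw [e]
  exact η.contDiff.mul (contDiff_rad_zero m)

/-- The truncated fundamental solution of `Δᵐ⁺¹` inverts `Δᵐ⁺¹` up to the convolution with a test
function. -/
theorem exists_parametrix (η : ContDiffBump (0 : E3)) (m : ℕ) :
    ∃ K, IsTest K ∧ tsupport K ⊆ Metric.closedBall 0 η.rOut ∧ ∀ g, IsTest g → ∀ x,
      cv (trunc η m) (lap^[m + 1] g) x = polyConst m * g x - cv K g x := by
  -- The complementary part of the fundamental solution is smooth at the origin.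
  set S : E3 → ℝ := fun y => (1 - η y) * rad 0 (m - 1 / 2) y with hS
  have hSs : ContDiff ℝ ∞ S := by
    rw [contDiff_iff_contDiffAt]
    intro y
    by_cases hy : y = 0
    · have : S =ᶠ[𝓝 y] fun _ => 0 := by
        rw [hy]
        exact η.eventuallyEq_one.mono fun z hz => by simp [hS, hz]
      exact contDiffAt_const.congr_of_eventuallyEq this
    · have h1 : ‖y‖ ^ 2 + 0 ≠ 0 := by simpa using hy
      exact (contDiffAt_const.sub η.contDiffAt).mul
        (((contDiff_norm_sq ℝ).contDiffAt.add contDiffAt_const).rpow_const_of_ne h1)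
  have hO : IsOpen (tsupport η)ᶜ := (isClosed_tsupport _).isOpen_compl
  have h0 : (0 : E3) ∉ (tsupport η)ᶜ := by
    rw [η.tsupport_eq]
    simp [η.rOut_pos.le]
  have hK0 := iterate_lap_rad_eq_zero m hO h0 (f := S) (c := 1) fun y hy => by
    simp [hS, image_eq_zero_of_notMem_tsupport hy]
  have hKs : tsupport (lap^[m + 1] S) ⊆ tsupport η :=
    closure_minimal (fun y hy => by_contra fun h => hy (hK0 y h)) (isClosed_tsupport _)
  have hK : IsTest (lap^[m + 1] S) := ⟨contDiff_iterate_lap hSs _,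
    η.hasCompactSupport.of_isClosed_subset (isClosed_tsupport _) hKs⟩
  refine ⟨lap^[m + 1] S, hK, by rwa [η.tsupport_eq] at hKs, fun g hg x => ?_⟩
  have hgx := hg.sub_left x
  have h1 := integral_rad_mul_iterate_lap m hgx
  have h2 := integral_mul_iterate_lap hSs hgx (m + 1)
  have hi := hgx.iterate_lap (m + 1)
  have i1 := hi.integrable_mul (integrable_trunc η m).locallyIntegrable
  have i2 := hi.integrable_mul hSs.continuous.locallyIntegrable
  have e : ∀ y, rad 0 (m - 1 / 2) y * (lap^[m + 1] fun z => g (x - z)) y =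
      trunc η m y * (lap^[m + 1] fun z => g (x - z)) y +
        S y * (lap^[m + 1] fun z => g (x - z)) y := by
    intro y
    simp only [trunc, hS]
    ring
  simp only [e] at h1
  rw [integral_add i1 i2, h2, sub_zero] at h1
  simp only [iterate_lap_sub_left g x (m + 1)] at h1
  simp only [cv]
  linarith

end

/-! ### The uniform bound -/

section

theorem HasWeakGradient.integral_mul_lap {u : E3 → ℝ} {g : E3 → E3} (h : HasWeakGradient u g)
    {φ : E3 → ℝ} (hφ : IsTest φ) :
    ∫ x, u x * lap φ x = - ∫ x, ⟪g x, gradient φ x⟫ := by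
  have e : ∀ x, ⟪g x, gradient φ x⟫ = ∑ i, pd i φ x * g x i := by
    intro x
    rw [PiLp.inner_apply]
    refine Finset.sum_congr rfl fun i _ => ?_
    rw [gradient_apply]
    simp
  simp only [e, lap, Finset.mul_sum]
  rw [integral_finsetSum, integral_finsetSum, ← Finset.sum_neg_distrib]
  · exact Finset.sum_congr rfl fun i _ => h.integral_pd (hφ.pd i) i
  · intro i _
    have := (hφ.pd i).integrable_mul (LocallyIntegrable.coord h.2.1 i)
    simpa [mul_comm] using this
  · exact fun i _ => ((hφ.pd i).pd i).integrable_mul h.1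

/-- The smooth convex function `√(1 + t²) - 1`, a substitute for `|t|`. -/
def softAbs (t : ℝ) : ℝ := √(1 + t ^ 2) - 1

/-- The derivative of `softAbs`, a substitute for the sign function. -/
def softSign (t : ℝ) : ℝ := t / √(1 + t ^ 2)

theorem contDiff_sqrt_one_add_sq : ContDiff ℝ ∞ fun t : ℝ => √(1 + t ^ 2) :=
  ContDiff.sqrt (by fun_prop) fun t => by positivity

theorem contDiff_softAbs : ContDiff ℝ ∞ softAbs := contDiff_sqrt_one_add_sq.sub contDiff_const

theorem contDiff_softSign : ContDiff ℝ ∞ softSign :=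
  contDiff_id.div contDiff_sqrt_one_add_sq fun t => by positivity

theorem hasDerivAt_sqrt_one_add_sq (t : ℝ) :
    HasDerivAt (fun t : ℝ => √(1 + t ^ 2)) (softSign t) t := by
  have h2 : HasDerivAt (fun t : ℝ => 1 + t ^ 2) (2 * t) t := by
    simpa using (hasDerivAt_pow 2 t).const_add 1
  convert! h2.sqrt (by positivity) using 1
  rw [softSign, mul_div_mul_left _ _ two_ne_zero]

theorem deriv_softAbs (t : ℝ) : deriv softAbs t = softSign t :=
  ((hasDerivAt_sqrt_one_add_sq t).sub_const 1).deriv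

theorem deriv_softSign (t : ℝ) : deriv softSign t = (√(1 + t ^ 2) ^ 3)⁻¹ := by
  have hp : 0 < √(1 + t ^ 2) := by positivity
  have hs : √(1 + t ^ 2) ^ 2 = 1 + t ^ 2 := Real.sq_sqrt (by positivity)
  have := ((hasDerivAt_id t).div (hasDerivAt_sqrt_one_add_sq t) hp.ne').deriv
  refine (this : deriv softSign t = _).trans ?_
  rw [softSign]
  simp only [id]
  field_simp
  linarith

theorem abs_le_sqrt_one_add_sq (t : ℝ) : |t| ≤ √(1 + t ^ 2) :=
  Real.abs_le_sqrt (by linarith)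

theorem one_le_sqrt_one_add_sq (t : ℝ) : 1 ≤ √(1 + t ^ 2) :=
  Real.one_le_sqrt.2 (by nlinarith)

theorem abs_softSign_le (t : ℝ) : |softSign t| ≤ 1 := by
  rw [softSign, abs_div, abs_of_nonneg (Real.sqrt_nonneg _),
    div_le_one (by positivity)]
  exact abs_le_sqrt_one_add_sq t

theorem mul_softSign_nonneg (t : ℝ) : 0 ≤ t * softSign t := by
  rw [softSign, ← mul_div_assoc]
  exact div_nonneg (mul_self_nonneg t) (Real.sqrt_nonneg _)

theorem deriv_softSign_nonneg (t : ℝ) : 0 ≤ deriv softSign t := by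
  rw [deriv_softSign]; positivity

theorem abs_deriv_softSign_le (t : ℝ) : |deriv softSign t| ≤ 1 := by
  rw [abs_of_nonneg (deriv_softSign_nonneg t), deriv_softSign]
  exact inv_le_one_of_one_le₀ (one_le_pow₀ (one_le_sqrt_one_add_sq t))

theorem abs_deriv_softAbs_le (t : ℝ) : |deriv softAbs t| ≤ 1 := by
  rw [deriv_softAbs]; exact abs_softSign_le t

theorem softAbs_nonneg (t : ℝ) : 0 ≤ softAbs t := sub_nonneg.2 (one_le_sqrt_one_add_sq t)

theorem softAbs_le_abs (t : ℝ) : softAbs t ≤ |t| := by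
  have : √(1 + t ^ 2) ≤ |t| + 1 :=
    Real.sqrt_le_iff.2 ⟨by positivity, by nlinarith [sq_abs t, abs_nonneg t]⟩
  rw [softAbs]
  linarith

theorem abs_le_softAbs_add_one (t : ℝ) : |t| ≤ softAbs t + 1 := by
  rw [softAbs]
  linarith [abs_le_sqrt_one_add_sq t]

variable {Ω : Set E3}

/-- Testing the equation with `ψ · softSign u` gives `-Δ (softAbs u) ≤ Λ |u| + P` in the sense of
distributions on the whole space, where `P` bounds the right-hand side of the equation. -/
theorem IsWeakSolution.integral_softAbs_mul_lap {lam Λ P : ℝ} {f u : E3 → ℝ}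
    (hu : IsWeakSolution Ω lam f u) (hΛ : lam ≤ Λ) (hΛ0 : 0 ≤ Λ)
    (hfm : AEStronglyMeasurable f (volume.restrict Ω)) (hf : ∀ x, |f x| ≤ P)
    {ψ : E3 → ℝ} (hψ : IsTest ψ) (hψ0 : ∀ x, 0 ≤ ψ x) :
    - ∫ x, softAbs (u x) * lap ψ x ≤ ∫ x, (Λ * |u x| + P) * ψ x := by
  have hu1 := hu.1.1
  have hP : 0 ≤ P := (abs_nonneg _).trans (hf 0)
  have hs0 : softSign 0 = 0 := by simp [softSign]
  obtain ⟨hφ, hφg⟩ := hu.1.mul_comp hψ contDiff_softSign hs0 abs_deriv_softSign_le abs_softSign_le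
  have heq := hu.2 _ hφ
  have hW : HasWeakGradient (fun x => softAbs (u x)) (fun x => softSign (u x) • weakGrad u x) := by
    simpa only [deriv_softAbs] using
      hu1.hasWeakGradient.comp hu1.1 hu1.memLp_weakGrad contDiff_softAbs abs_deriv_softAbs_le
  have hwg2 : MemLp (fun x => softSign (u x) • weakGrad u x) 2 := by
    refine hu1.memLp_weakGrad.of_le_mul (c := 1)
      ((contDiff_softSign.continuous.comp_aestronglyMeasurable hu1.1.1).smul hu1.memLp_weakGrad.1)
      (Eventually.of_forall fun x => ?_)
    rw [norm_smul]
    gcongr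
    exact abs_softSign_le _
  have hgψ : MemLp (gradient ψ) 2 := (continuous_gradient hψ.smooth).memLp_of_hasCompactSupport
    (hasCompactSupport_gradient hψ.supp)
  rw [hW.integral_mul_lap hψ, neg_neg]
  have h1 : ∫ x, ⟪softSign (u x) • weakGrad u x, gradient ψ x⟫ =
      ∫ x in Ω, ⟪softSign (u x) • weakGrad u x, gradient ψ x⟫ := by
    refine (setIntegral_eq_integral_of_ae_compl_eq_zero
      (hu.1.ae_eq_zero.mono fun x hx hxΩ => ?_)).symm
    simp [hx hxΩ, hs0]
  have h2 : ∫ x in Ω, ⟪softSign (u x) • weakGrad u x, gradient ψ x⟫ ≤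
      ∫ x in Ω, ⟪weakGrad u x, weakGrad (fun x => ψ x * softSign (u x)) x⟫ := by
    refine integral_mono_ae (integrable_inner_of_memLp hwg2 hgψ).restrict
      (integrable_inner_of_memLp hu1.memLp_weakGrad hφ.1.memLp_weakGrad).restrict
      (ae_restrict_of_ae (hφg.mono fun x hx => ?_))
    simp only
    rw [hx, inner_add_right, inner_smul_right, inner_smul_right, inner_smul_right,
      inner_smul_left, real_inner_self_eq_norm_sq]
    -- Dropping this nonnegative term uses that `softAbs` is convex.
    have := mul_nonneg (hψ0 x) (mul_nonneg (deriv_softSign_nonneg (u x)) (sq_nonneg ‖weakGrad u x‖))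
    simp only [conj_trivial]
    linarith
  have i1 : Integrable (fun x => u x * (ψ x * softSign (u x))) (volume.restrict Ω) :=
    (hu1.1.integrable_mul hφ.1.1).restrict
  have i2 : Integrable (fun x => f x * (ψ x * softSign (u x))) (volume.restrict Ω) := by
    refine ((hψ.integrable.norm.const_mul P).restrict (s := Ω)).mono'
      (hfm.mul hφ.1.1.1.restrict) (Eventually.of_forall fun x => ?_)
    rw [norm_mul, norm_mul]
    have := mul_le_mul_of_nonneg_left (abs_softSign_le (u x)) (norm_nonneg (ψ x))
    rw [mul_one] at this
    exact mul_le_mul (hf x) this (by positivity) hP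
  have hFl : LocallyIntegrable fun x => Λ * |u x| + P :=
    LocallyIntegrable.add (LocallyIntegrable.smul (fun x => (hu1.hasWeakGradient.1 x).norm) Λ)
      (locallyIntegrable_const P)
  have i3 := hψ.integrable_mul hFl
  calc ∫ x, ⟪softSign (u x) • weakGrad u x, gradient ψ x⟫
      ≤ ∫ x in Ω, ⟪weakGrad u x, weakGrad (fun x => ψ x * softSign (u x)) x⟫ := h1.trans_le h2
    _ = lam * (∫ x in Ω, u x * (ψ x * softSign (u x))) +
          ∫ x in Ω, f x * (ψ x * softSign (u x)) := by linarith
    _ = ∫ x in Ω, (lam * (u x * (ψ x * softSign (u x))) + f x * (ψ x * softSign (u x))) := by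
        rw [integral_add (i1.const_mul lam) i2, integral_const_mul]
    _ ≤ ∫ x in Ω, (Λ * |u x| + P) * ψ x := by
        refine integral_mono ((i1.const_mul lam).add i2) i3.restrict fun x => ?_
        have h3 := mul_softSign_nonneg (u x)
        have h4 : u x * softSign (u x) ≤ |u x| := by
          refine (le_abs_self _).trans ?_
          rw [abs_mul]
          exact mul_le_of_le_one_right (abs_nonneg _) (abs_softSign_le _)
        have h5 : f x * softSign (u x) ≤ P := by
          refine (le_abs_self _).trans ?_
          rw [abs_mul]
          exact (mul_le_of_le_one_right (abs_nonneg _) (abs_softSign_le _)).trans (hf x)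
        have h6 : lam * (u x * softSign (u x)) ≤ Λ * |u x| :=
          (mul_le_mul_of_nonneg_right hΛ h3).trans (mul_le_mul_of_nonneg_left h4 hΛ0)
        simp only
        nlinarith [hψ0 x]
    _ ≤ ∫ x, (Λ * |u x| + P) * ψ x :=
        setIntegral_le_integral i3 (Eventually.of_forall fun x =>
          mul_nonneg (by positivity) (hψ0 x))

/-- Testing with the mollifiers turns an inequality of distributions into one almost everywhere. -/
theorem ae_le_of_forall_isTest {W : E3 → ℝ} (hW : LocallyIntegrable W) {M : ℝ}
    (h : ∀ g, IsTest g → (∀ x, 0 ≤ g x) → ∫ x, W x * g x ≤ M * ∫ x, g x) :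
    ∀ᵐ x, W x ≤ M := by
  filter_upwards [ae_tendsto_mol hW] with x hx
  refine le_of_tendsto' hx fun n => ?_
  have h1 := h _ ((isTest_bump n).sub_left x) fun y => (bump n).nonneg_normed _
  rw [integral_sub_left_eq_self _ volume x, (bump n).integral_normed, mul_one] at h1
  rw [mol_apply_swap]
  simpa only [mul_comm] using h1

theorem abs_integral_mul_sub_le {f k : E3 → ℝ} (hf : MemLp f 2) (hk : MemLp k 2) (z : E3) :
    Integrable (fun x => f x * k (x - z)) ∧
      |∫ x, f x * k (x - z)| ≤ ((∫ x, f x ^ 2) + ∫ x, k x ^ 2) / 2 := by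
  have hkz : MemLp (fun x => k (x - z)) 2 :=
    hk.comp_measurePreserving (measurePreserving_sub_right volume z)
  have hi : Integrable (fun x => f x * k (x - z)) := hf.integrable_mul hkz
  refine ⟨hi, ?_⟩
  have e : ∫ x, k (x - z) ^ 2 = ∫ x, k x ^ 2 :=
    integral_sub_right_eq_self (fun x => k x ^ 2) z
  rw [← e, ← integral_add hf.integrable_sq hkz.integrable_sq, ← integral_div]
  refine (norm_integral_le_integral_norm _).trans (integral_mono hi.norm
    ((hf.integrable_sq.add hkz.integrable_sq).div_const 2) fun x => ?_)
  change ‖f x * k (x - z)‖ ≤ (f x ^ 2 + k (x - z) ^ 2) / 2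
  rw [norm_mul, Real.norm_eq_abs, Real.norm_eq_abs, ← sq_abs (f x), ← sq_abs (k (x - z))]
  nlinarith [sq_nonneg (|f x| - |k (x - z)|)]

/-- A cutoff function equal to `1` on the unit ball. -/
def unitCutoff : ContDiffBump (0 : E3) where
  rIn := 1
  rOut := 2
  rIn_pos := one_pos
  rIn_lt_rOut := one_lt_two

/-- The smooth error kernel of the parametrix of `Δ` with the cutoff `unitCutoff`. -/
def errorKernel : E3 → ℝ := (exists_parametrix unitCutoff 0).choose

/-- The truncated Newtonian kernel is square integrable: `|y|⁻²` is locally integrable in dimension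
three. -/
theorem memLp_trunc_zero (η : ContDiffBump (0 : E3)) : MemLp (trunc η 0) 2 := by
  rw [memLp_two_iff_integrable_sq (integrable_trunc η 0).1]
  have h := ((isTest_contDiffBump η).mul_left η.contDiff).integrable_mul
    (locallyIntegrable_norm_inv_pow le_rfl)
  refine h.congr (Eventually.of_forall fun y => ?_)
  have := rad_zero_neg_half y
  rw [neg_div] at this
  simp only [trunc, Nat.cast_zero, zero_sub, this]
  rw [mul_pow, inv_pow]
  ring

theorem trunc_nonneg (η : ContDiffBump (0 : E3)) (m : ℕ) (y : E3) : 0 ≤ trunc η m y :=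
  mul_nonneg η.nonneg (rad_nonneg le_rfl _ _)

/-- The bound for normalized weak solutions with `lam ≤ Λ` and right-hand side at most `P`. -/
def supBound (Λ P : ℝ) : ℝ :=
  ((1 + ∫ x, errorKernel x ^ 2) / 2 + (Λ * ((1 + ∫ x, trunc unitCutoff 0 x ^ 2) / 2) +
    P * ∫ x, trunc unitCutoff 0 x)) / newtonConst + 1

/-- The uniform bound: the parametrix is square integrable in dimension three, so the differential
inequality for `softAbs u` bounds it by the `L²` norm of `u`. -/
theorem IsWeakSolution.ae_abs_le {lam Λ P : ℝ} {f u : E3 → ℝ}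
    (hu : IsWeakSolution Ω lam f u) (hu2 : ∫ x, u x ^ 2 = 1) (hΛ : lam ≤ Λ) (hΛ0 : 0 ≤ Λ)
    (hfm : AEStronglyMeasurable f (volume.restrict Ω)) (hf : ∀ x, |f x| ≤ P) :
    ∀ᵐ x, |u x| ≤ supBound Λ P := by
  have hu1 := hu.1.1
  have hP : 0 ≤ P := (abs_nonneg _).trans (hf 0)
  obtain ⟨hK, -, hpar⟩ := (exists_parametrix unitCutoff 0).choose_spec
  change IsTest errorKernel at hK
  set N := trunc unitCutoff 0 with hN
  have hNi : Integrable N := integrable_trunc _ _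
  have hNs : HasCompactSupport N := hasCompactSupport_trunc _ _
  have hN2 : MemLp N 2 := memLp_trunc_zero _
  set W : E3 → ℝ := fun x => softAbs (u x) with hW
  have hW2 : MemLp W 2 := hu1.1.of_le
    (contDiff_softAbs.continuous.comp_aestronglyMeasurable hu1.1.1)
    (Eventually.of_forall fun x => by
      rw [Real.norm_of_nonneg (softAbs_nonneg _)]; exact softAbs_le_abs _)
  have hWl : LocallyIntegrable W := hW2.locallyIntegrable (by norm_num)
  have hWn : ∫ x, W x ^ 2 ≤ 1 := by
    rw [← hu2]
    refine integral_mono hW2.integrable_sq hu1.1.integrable_sq fun x => ?_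
    simp only [hW]
    rw [← sq_abs (u x)]
    exact pow_le_pow_left₀ (softAbs_nonneg _) (softAbs_le_abs _) 2
  have hua : MemLp (fun x => |u x|) 2 := hu1.1.norm
  have hFl : LocallyIntegrable fun x => Λ * |u x| + P :=
    LocallyIntegrable.add (LocallyIntegrable.smul (fun x => (hu1.hasWeakGradient.1 x).norm) Λ)
      (locallyIntegrable_const P)
  set A := (1 + ∫ x, errorKernel x ^ 2) / 2 with hA
  set B := Λ * ((1 + ∫ x, N x ^ 2) / 2) + P * ∫ x, N x with hB
  have hmain : ∀ᵐ x, W x ≤ (A + B) / newtonConst := by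
    refine ae_le_of_forall_isTest hWl fun g hg hg0 => ?_
    -- The differential inequality is tested with `N ⋆ g`, whose Laplacian is `g` up to a constant
    -- and a smooth error.
    have hφ := hg.cv hNi.locallyIntegrable hNs
    have hφ0 : ∀ x, 0 ≤ cv N g x := fun x =>
      integral_nonneg fun y => mul_nonneg (trunc_nonneg _ _ _) (hg0 _)
    have hsub := hu.integral_softAbs_mul_lap hΛ hΛ0 hfm hf hφ hφ0
    have hlap : ∀ x, lap (cv N g) x = -newtonConst * g x - cv errorKernel g x := by
      intro x
      rw [lap_cv hg hNi.locallyIntegrable]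
      exact hpar g hg x
    simp only [hlap] at hsub
    obtain ⟨j1, e1⟩ := integral_mul_cv hWl hK.integrable hK.supp hg
    obtain ⟨j2, e2⟩ := integral_mul_cv hFl hNi hNs hg
    have i1 := hg.integrable_mul hWl
    have i2 : Integrable fun x => W x * cv errorKernel g x :=
      (hg.cv hK.integrable.locallyIntegrable hK.supp).integrable_mul hWl
    have e3 : ∫ x, W x * (-newtonConst * g x - cv errorKernel g x) =
        -newtonConst * (∫ x, W x * g x) - ∫ x, W x * cv errorKernel g x := by
      rw [← integral_const_mul, ← integral_sub (i1.const_mul _) i2]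
      congr 1; ext x; ring
    have b1 : -(A * ∫ x, g x) ≤ ∫ x, W x * cv errorKernel g x := by
      rw [e1, ← integral_const_mul, ← integral_neg]
      refine integral_mono (hg.integrable.const_mul A).neg j1 fun z => ?_
      have h1 := (abs_integral_mul_sub_le hW2 (hK.memLp 2) z).2
      have h2 := neg_abs_le (∫ x, W x * errorKernel (x - z))
      have h3 : -A ≤ ∫ x, W x * errorKernel (x - z) := by linarith
      have := mul_le_mul_of_nonneg_right h3 (hg0 z)
      simp only
      linarith
    have b2 : ∫ x, (Λ * |u x| + P) * cv N g x ≤ B * ∫ x, g x := by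
      rw [e2, ← integral_const_mul]
      refine integral_mono j2 (hg.integrable.const_mul B) fun z => ?_
      refine mul_le_mul_of_nonneg_right ?_ (hg0 z)
      obtain ⟨k1, k2⟩ := abs_integral_mul_sub_le hua hN2 z
      have k3 : Integrable fun x => N (x - z) := hNi.comp_sub_right z
      have e4 : ∫ x, (Λ * |u x| + P) * N (x - z) =
          Λ * (∫ x, |u x| * N (x - z)) + P * ∫ x, N x := by
        rw [← integral_sub_right_eq_self N z, ← integral_const_mul, ← integral_const_mul,
          ← integral_add (k1.const_mul Λ) (k3.const_mul P)]
        congr 1; ext x; ring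
      simp only [sq_abs] at k2
      rw [hu2] at k2
      rw [e4, hB]
      gcongr
      exact (le_abs_self _).trans k2
    have hc := newtonConst_pos
    rw [e3] at hsub
    rw [div_mul_eq_mul_div, le_div_iff₀ hc]
    linarith
  filter_upwards [hmain] with x hx
  refine (abs_le_softAbs_add_one (u x)).trans ?_
  rw [supBound]
  exact add_le_add_left hx 1

end

/-! ### Interior smoothness -/

section

variable {U Ω : Set E3}

theorem contDiff_integral_mul_sub {w k : E3 → ℝ} (hw : LocallyIntegrable w) {n : ℕ∞}
    (hk : ContDiff ℝ n k) (hks : HasCompactSupport k) :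
    ContDiff ℝ n fun z => ∫ x, w x * k (x - z) := by
  have hs : HasCompactSupport fun y => k (-y) := hks.comp_homeomorph (Homeomorph.neg E3)
  have h := hs.contDiff_convolution_left (ContinuousLinearMap.lsmul ℝ ℝ) (μ := volume)
    (hk.comp contDiff_neg) hw
  have e : (fun z => ∫ x, w x * k (x - z)) =
      ((fun y => k (-y)) ⋆[ContinuousLinearMap.lsmul ℝ ℝ, volume] w) := by
    ext z
    rw [convolution_eq_swap]
    refine integral_congr_ae (Eventually.of_forall fun x => ?_)
    simp [mul_comm]
  rw [e]
  exact h

theorem tsupport_cv_subset {k g : E3 → ℝ} (hk : HasCompactSupport k) (hg : HasCompactSupport g) :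
    tsupport (cv k g) ⊆ tsupport k + tsupport g := by
  refine closure_minimal ?_ (hk.isCompact.add hg.isCompact).isClosed
  exact (support_convolution_subset (ContinuousLinearMap.lsmul ℝ ℝ)).trans
    (add_subset_add (subset_tsupport k) (subset_tsupport g))

/-- For a closed linear system `Δu = αu + βv`, `Δv = γu + δv` of distributions, every power of the
Laplacian of `u` is a linear combination of `u` and `v`. -/
theorem exists_integral_mul_iterate_lap {u v : E3 → ℝ} {α β γ δ : ℝ}
    (hu : ∀ φ, IsTest φ → tsupport φ ⊆ U →
      ∫ x, u x * lap φ x = α * (∫ x, u x * φ x) + β * ∫ x, v x * φ x)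
    (hv : ∀ φ, IsTest φ → tsupport φ ⊆ U →
      ∫ x, v x * lap φ x = γ * (∫ x, u x * φ x) + δ * ∫ x, v x * φ x) (k : ℕ) :
    ∃ a b : ℝ, ∀ φ, IsTest φ → tsupport φ ⊆ U →
      ∫ x, u x * (lap^[k] φ) x = a * (∫ x, u x * φ x) + b * ∫ x, v x * φ x := by
  induction k with
  | zero => exact ⟨1, 0, fun φ _ _ => by simp⟩
  | succ k ih =>
    obtain ⟨a, b, h⟩ := ih
    refine ⟨a * α + b * γ, a * β + b * δ, fun φ hφ hφU => ?_⟩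
    rw [Function.iterate_succ_apply, h _ hφ.lap ((tsupport_lap_subset φ).trans hφU), hu φ hφ hφU,
      hv φ hφ hφU]
    ring

/-- Local regularity: `u` is represented on a small ball by the convolution of `u` and `v` with
kernels of class `Cᵐ`. -/
theorem exists_contDiff_ae_eq {u v : E3 → ℝ} (hul : LocallyIntegrable u)
    (hvl : LocallyIntegrable v) {x₀ : E3} {r : ℝ} (hr : 0 < r) (hrU : Metric.ball x₀ (2 * r) ⊆ U)
    {a b : ℝ} {m : ℕ} (h : ∀ φ, IsTest φ → tsupport φ ⊆ U →
      ∫ x, u x * (lap^[m + 1 + 1] φ) x = a * (∫ x, u x * φ x) + b * ∫ x, v x * φ x) :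
    ∃ w : E3 → ℝ, ContDiff ℝ m w ∧ ∀ᵐ x, x ∈ Metric.ball x₀ r → u x = w x := by
  let η : ContDiffBump (0 : E3) := ⟨r / 2, r, by positivity, by linarith⟩
  obtain ⟨K, hK, -, hpar⟩ := exists_parametrix η (m + 1)
  set N := trunc η (m + 1) with hN
  have hNi : Integrable N := integrable_trunc _ _
  have hNs : HasCompactSupport N := hasCompactSupport_trunc _ _
  have hNt : tsupport N ⊆ Metric.closedBall 0 r := by
    refine (closure_mono fun y hy => ?_).trans η.tsupport_eq.subset
    exact left_ne_zero_of_mul hy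
  set c := polyConst (m + 1) with hc
  have hc0 : c ≠ 0 := polyConst_ne_zero _
  set F : E3 → ℝ := fun x => a * u x + b * v x with hF
  have hFl : LocallyIntegrable F := (hul.smul a).add (hvl.smul b)
  set w : E3 → ℝ := fun z => c⁻¹ * ((∫ x, u x * K (x - z)) + ∫ x, F x * N (x - z)) with hw
  have hws : ContDiff ℝ m w :=
    contDiff_const.mul ((contDiff_integral_mul_sub hul (hK.smooth.of_le (by exact_mod_cast le_top))
      hK.supp).add (contDiff_integral_mul_sub hFl (contDiff_trunc η m) hNs))
  refine ⟨w, hws, ?_⟩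
  have hul' : LocallyIntegrable fun x => u x - w x := hul.sub hws.continuous.locallyIntegrable
  have key := Metric.isOpen_ball.ae_eq_zero_of_integral_contDiff_smul_eq_zero
    (U := Metric.ball x₀ r) (hul'.locallyIntegrableOn _) fun g hgs hgc hgU => ?_
  · exact key.mono fun x hx hxB => sub_eq_zero.1 (hx hxB)
  have hg : IsTest g := ⟨hgs, hgc⟩
  have hφ := hg.cv hNi.locallyIntegrable hNs
  have hφU : tsupport (cv N g) ⊆ U := by
    refine (tsupport_cv_subset hNs hgc).trans (subset_trans ?_ hrU)
    rintro _ ⟨y, hy, z, hz, rfl⟩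
    have h1 := hNt hy
    have h2 := hgU hz
    rw [Metric.mem_closedBall, dist_zero_right] at h1
    rw [Metric.mem_ball, dist_eq_norm] at h2 ⊢
    calc ‖y + z - x₀‖ = ‖y + (z - x₀)‖ := by rw [add_sub_assoc]
      _ ≤ ‖y‖ + ‖z - x₀‖ := norm_add_le _ _
      _ < 2 * r := by linarith
  have e0 := h _ hφ hφU
  have hlap : ∀ x, (lap^[m + 1 + 1] (cv N g)) x = c * g x - cv K g x := by
    intro x
    rw [iterate_lap_cv hg hNi.locallyIntegrable]
    exact hpar g hg x
  simp only [hlap] at e0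
  obtain ⟨j1, e1⟩ := integral_mul_cv hul hK.integrable hK.supp hg
  obtain ⟨j2, e2⟩ := integral_mul_cv hFl hNi hNs hg
  have i1 := hg.integrable_mul hul
  have i2 := (hg.cv hK.integrable.locallyIntegrable hK.supp).integrable_mul hul
  have e3 : ∫ x, u x * (c * g x - cv K g x) =
      c * (∫ x, u x * g x) - ∫ x, u x * cv K g x := by
    rw [← integral_const_mul, ← integral_sub (i1.const_mul _) i2]
    congr 1; ext x; ring
  have e4 : a * (∫ x, u x * cv N g x) + b * (∫ x, v x * cv N g x) = ∫ x, F x * cv N g x := by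
    rw [← integral_const_mul, ← integral_const_mul,
      ← integral_add ((hφ.integrable_mul hul).const_mul a) ((hφ.integrable_mul hvl).const_mul b)]
    congr 1; ext x; simp only [hF]; ring
  have e5 : ∫ x, w x * g x = c⁻¹ * ((∫ z, (∫ x, u x * K (x - z)) * g z) +
      ∫ z, (∫ x, F x * N (x - z)) * g z) := by
    rw [← integral_add j1 j2, ← integral_const_mul]
    congr 1; ext x; simp only [hw]; ring
  have e6 : ∫ x, g x • (u x - w x) = (∫ x, u x * g x) - ∫ x, w x * g x := by
    rw [← integral_sub i1 (hg.integrable_mul hws.continuous.locallyIntegrable)]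
    congr 1; ext x; simp only [smul_eq_mul]; ring
  rw [e3, e4, e1, e2] at e0
  have e7 : c * ∫ x, u x * g x = (∫ z, (∫ x, u x * K (x - z)) * g z) +
      ∫ z, (∫ x, F x * N (x - z)) * g z := by linarith
  rw [e6, e5, ← e7, inv_mul_cancel_left₀ hc0, sub_self]

/-- The mollifications of `u` converge everywhere on a ball where `u` has a continuous
representative. -/
theorem tendsto_mol_of_ae_eq {u w : E3 → ℝ} (hw : Continuous w) {x₀ : E3} {r : ℝ}
    (h : ∀ᵐ x, x ∈ Metric.ball x₀ r → u x = w x) {x : E3} (hx : x ∈ Metric.ball x₀ r) :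
    Tendsto (fun n => mol n u x) atTop (𝓝 (w x)) := by
  have h1 : Tendsto (fun n => mol n w x) atTop (𝓝 (w x)) :=
    ContDiffBump.convolution_tendsto_right_of_continuous tendsto_bump_rOut hw x
  have hpos : 0 < r - dist x x₀ := sub_pos.2 hx
  refine h1.congr' ?_
  filter_upwards [tendsto_bump_rOut.eventually (gt_mem_nhds hpos)] with n hn
  rw [mol_apply_swap, mol_apply_swap]
  refine integral_congr_ae (h.mono fun t ht => ?_)
  by_cases hz : (bump n).normed volume (x - t) = 0
  · simp [hz]
  · have h2 : x - t ∈ Metric.ball (0 : E3) (bump n).rOut := by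
      rw [← (bump n).support_normed_eq (μ := volume)]; exact hz
    rw [Metric.mem_ball, dist_zero_right] at h2
    have h3 : t ∈ Metric.ball x₀ r := by
      rw [Metric.mem_ball]
      have := dist_triangle_left t x₀ x
      rw [dist_eq_norm x t] at this
      linarith
    simp only
    rw [ht h3]

/-- Interior regularity for a linear system of two equations: `u` has a smooth representative. The
representative is the pointwise limit of the mollifications of `u`. -/
theorem exists_contDiffOn_of_system {u v : E3 → ℝ} (hul : LocallyIntegrable u)
    (hvl : LocallyIntegrable v) (hU : IsOpen U) {α β γ δ : ℝ}
    (hu : ∀ φ, IsTest φ → tsupport φ ⊆ U →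
      ∫ x, u x * lap φ x = α * (∫ x, u x * φ x) + β * ∫ x, v x * φ x)
    (hv : ∀ φ, IsTest φ → tsupport φ ⊆ U →
      ∫ x, v x * lap φ x = γ * (∫ x, u x * φ x) + δ * ∫ x, v x * φ x) :
    ∃ w : E3 → ℝ, ContDiffOn ℝ ∞ w U ∧ w =ᵐ[volume] u := by
  refine ⟨fun x => limUnder atTop fun n => mol n u x, ?_, ?_⟩
  · rw [contDiffOn_infty]
    intro m x₀ hx₀
    obtain ⟨R, hR, hRU⟩ := Metric.isOpen_iff.1 hU x₀ hx₀
    obtain ⟨a, b, h⟩ := exists_integral_mul_iterate_lap hu hv (m + 1 + 1)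
    obtain ⟨w, hw, hae⟩ := exists_contDiff_ae_eq hul hvl (r := R / 2) (by positivity)
      (by rwa [mul_div_cancel₀ R two_ne_zero]) h
    refine ContDiffAt.contDiffWithinAt (hw.contDiffAt.congr_of_eventuallyEq ?_)
    filter_upwards [Metric.ball_mem_nhds x₀ (by positivity : 0 < R / 2)] with x hx
    exact (tendsto_mol_of_ae_eq hw.continuous hae hx).limUnder_eq
  · exact (ae_tendsto_mol hul).mono fun x hx => hx.limUnder_eq

theorem locallyIntegrable_potential (hΩ : volume Ω ≠ ⊤) {u : E3 → ℝ}
    (hu : MemLp u 2 (volume.restrict Ω)) : LocallyIntegrable (potential Ω u) := by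
  rw [locallyIntegrable_iff]
  intro K hK
  have h1 : Integrable (fun _ : E3 => (1 : ℝ)) (volume.restrict K) := by
    rw [← IntegrableOn]
    exact integrableOn_const hK.measure_lt_top.ne
  simpa [IntegrableOn] using integrable_mul_potential hΩ hu h1

/-- The Coulomb potential solves `-Δv = newtonConst · u` in the sense of distributions. -/
theorem integral_potential_mul_lap (hΩ : volume Ω ≠ ⊤) {u : E3 → ℝ} (hu : MemH10 Ω u) {φ : E3 → ℝ}
    (hφ : IsTest φ) :
    ∫ x, potential Ω u x * lap φ x = -newtonConst * ∫ x, u x * φ x := by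
  have h1 : ∀ y, ∫ x, lap φ x / ‖x - y‖ = -newtonConst * φ y := by
    intro y
    have h2 := integral_norm_inv_mul_lap (hφ.sub_left y)
    rw [lap_sub_left, sub_zero] at h2
    rw [← h2, ← integral_sub_left_eq_self _ volume y]
    refine integral_congr_ae (Eventually.of_forall fun z => ?_)
    simp only [rad_zero_neg_half]
    rw [sub_sub_cancel_left, norm_neg, div_eq_mul_inv, mul_comm]
  have h3 := integral_mul_potential hΩ (hu.1.1.restrict Ω) (μ := volume) hφ.lap.integrable
  simp only [h1] at h3
  simp only [mul_comm (potential Ω u _)]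
  rw [h3, ← integral_const_mul]
  rw [setIntegral_eq_integral_of_ae_compl_eq_zero
    (hu.ae_eq_zero.mono fun x hx hxΩ => by rw [hx hxΩ, zero_mul])]
  congr 1; ext x; ring

/-- A weak solution satisfies the equation in the sense of distributions on every open set
contained in `Ω` up to a set of zero capacity. -/
theorem IsWeakSolution.integral_mul_lap {lam : ℝ} {f u : E3 → ℝ} (hu : IsWeakSolution Ω lam f u)
    (hU : capacity (U \ Ω) = 0) {φ : E3 → ℝ} (hφ : IsTest φ) (hφU : tsupport φ ⊆ U) :
    ∫ x, u x * lap φ x = -lam * (∫ x, u x * φ x) - ∫ x, f x * φ x := by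
  have hcap : capacity (Function.support φ \ Ω) = 0 := by
    refine nonpos_iff_eq_zero.1 ((capacity_mono ?_).trans hU.le)
    exact sdiff_subset_sdiff_left ((subset_tsupport φ).trans hφU)
  have heq := hu.2 φ (hφ.memH10 hcap)
  have hg := (hasWeakGradient_of_contDiff hφ.smooth).weakGrad_ae_eq
  have hnull := measure_eq_zero_iff_ae_notMem.1 (volume_eq_zero_of_capacity_eq_zero hU)
  have hout : ∀ᵐ x, x ∉ Ω → x ∉ tsupport φ :=
    hnull.mono fun x hx hxΩ hxφ => hx ⟨hφU hxφ, hxΩ⟩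
  rw [setIntegral_eq_integral_of_ae_compl_eq_zero, setIntegral_eq_integral_of_ae_compl_eq_zero,
    setIntegral_eq_integral_of_ae_compl_eq_zero] at heq
  · have e : ∫ x, ⟪weakGrad u x, weakGrad φ x⟫ = ∫ x, ⟪weakGrad u x, gradient φ x⟫ :=
      integral_congr_ae (hg.mono fun x hx => by simp only [hx])
    rw [hu.1.1.hasWeakGradient.integral_mul_lap hφ, ← e]
    linarith
  · exact hout.mono fun x hx hxΩ => by rw [image_eq_zero_of_notMem_tsupport (hx hxΩ), mul_zero]
  · exact hout.mono fun x hx hxΩ => by rw [image_eq_zero_of_notMem_tsupport (hx hxΩ), mul_zero]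
  · filter_upwards [hout, hg] with x hx hgx hxΩ
    have h0 : fderiv ℝ φ x = 0 := by
      by_contra h
      exact hx hxΩ (tsupport_fderiv_subset ℝ (subset_tsupport _ h))
    rw [hgx, gradient, h0, map_zero, inner_zero_right]

/-- The system is `Δu = -lam u + (q/2) v` and `Δv = -newtonConst u`. -/
theorem IsWeakSolution.isSmoothIn (hΩ : volume Ω ≠ ⊤) {lam q : ℝ} {u : E3 → ℝ}
    (hu : IsWeakSolution Ω lam (fun x => -(q / 2) * potential Ω u x) u) : IsSmoothIn Ω u := by
  intro U hU hcap
  have hu2 := hu.1.1.1.restrict Ω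
  obtain ⟨w, hw, hwu⟩ := exists_contDiffOn_of_system (U := U) (u := u) (v := potential Ω u)
    (α := -lam) (β := q / 2) (γ := -newtonConst) (δ := 0) hu.1.1.hasWeakGradient.1
    (locallyIntegrable_potential hΩ hu2) hU
    (fun φ hφ hφU => by
      rw [hu.integral_mul_lap hcap hφ hφU]
      simp only [mul_assoc, integral_const_mul]
      ring)
    (fun φ hφ _ => by rw [integral_potential_mul_lap hΩ hu.1 hφ]; ring)
  exact ⟨w, hw, ae_restrict_of_ae hwu⟩

/-! ### Admissible functions on the unit ball -/

theorem exists_isAdmissible_ball : ∃ u, IsAdmissible (Metric.ball (0 : E3) 1) u := by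
  let b : ContDiffBump (0 : E3) := ⟨1 / 4, 1 / 2, by norm_num, by norm_num⟩
  have hb : IsTest b := isTest_contDiffBump b
  have hsupp : ∀ x, x ∉ Metric.ball (0 : E3) 1 → b x = 0 := by
    intro x hx
    refine b.zero_of_le_dist ?_
    have : 1 ≤ dist x 0 := by simpa using hx
    exact le_trans (by norm_num [b]) this
  have hmem : MemH10 (Metric.ball (0 : E3) 1) b := by
    refine hb.memH10 ?_
    have : Function.support b \ Metric.ball (0 : E3) 1 = ∅ :=
      sdiff_eq_empty.2 fun x hx => by_contra fun h => hx (hsupp x h)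
    rw [this, capacity_empty]
  set s := ∫ x in Metric.ball (0 : E3) 1, b x ^ 2 with hs
  have hs0 : 0 < s := by
    rw [hs, setIntegral_eq_integral_of_forall_compl_eq_zero fun x hx => by rw [hsupp x hx]; simp]
    refine Continuous.integral_pos_of_hasCompactSupport_nonneg_nonzero (x := 0)
      (b.continuous.pow 2) ?_ (fun x => sq_nonneg _) ?_
    · exact b.hasCompactSupport.comp_left (g := fun t => t ^ 2) (by simp)
    · rw [b.one_of_mem_closedBall (Metric.mem_closedBall_self b.rIn_pos.le)]
      norm_num
  -- The normalization of `b`, written as a linear combination.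
  refine ⟨fun x => 1 / √s * b x + 0 * b x, hmem.linear hmem _ _, ?_⟩
  have hb2 := (hb.memLp 2).restrict (Metric.ball (0 : E3) 1)
  rw [integral_sq_linear hb2 hb2, ← hs, div_pow, Real.sq_sqrt hs0.le]
  field_simp
  ring

end

end CoulombShape

end

open CoulombShape

theorem theorem3p2 :
    ∃ C : ℝ → ℝ, ∀ (q : ℝ) (Ω : Set E3), 0 ≤ q → q < 1 →
      IsQuasiOpen Ω → volume Ω ≠ ⊤ →
      groundEnergy q Ω ≤ groundEnergy 1 (Metric.ball (0 : E3) 1) →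
      ∀ u : E3 → ℝ, IsOptimal q Ω u →
        IsWeakSolution Ω (dirichlet Ω u + q / 2 * coulomb Ω u u)
          (fun x => -(q / 2) * potential Ω u x) u ∧
        IsSmoothIn Ω u ∧
        eLpNorm u ∞ (volume.restrict Ω) ≤ ENNReal.ofReal (C (volume.real Ω)) ∧
        eLpNorm (potential Ω u) ∞ volume ≤ ENNReal.ofReal (C (volume.real Ω)) := by
  obtain ⟨u₀, hu₀⟩ := exists_isAdmissible_ball
  -- The maximum with `0` makes the bound nonnegative without any discussion of the sign of `D`.
  set Λ := max 0 (energy 1 (Metric.ball (0 : E3) 1) u₀) with hΛ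
  refine ⟨fun m => max (supBound Λ ((1 + (ballConst + m)) / 2)) ((1 + (ballConst + m)) / 2),
    fun q Ω hq0 hq1 _ hΩ hE u hu => ?_⟩
  have hw := hu.isWeakSolution hΩ
  have hu1 := hu.1.1.1
  have hu2 := hu1.1.restrict Ω
  set P := (1 + (ballConst + volume.real Ω)) / 2 with hP
  have hpot : ∀ x, |potential Ω u x| ≤ P := by
    intro x
    have := abs_potential_le hΩ hu2 x
    rwa [potBound, hu.1.2] at this
  have hlam : energy q Ω u ≤ Λ := by
    refine le_trans ?_ (le_max_right _ _)
    rw [← EReal.coe_le_coe_iff, hu.2]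
    exact hE.trans (iInf₂_le _ hu₀)
  have hn : ∫ x, u x ^ 2 = 1 := by
    rw [← hu.1.2]
    exact (setIntegral_eq_integral_of_ae_compl_eq_zero
      (hu.1.1.ae_eq_zero.mono fun x hx hxΩ => by rw [hx hxΩ]; simp)).symm
  have hbound := hw.ae_abs_le (P := P) hn hlam (le_max_left _ _)
    ((locallyIntegrable_potential hΩ hu2).aestronglyMeasurable.const_mul _).restrict fun x => by
      have h := hpot x
      rw [abs_mul, abs_neg, abs_of_nonneg (by positivity)]
      nlinarith [abs_nonneg (potential Ω u x)]
  refine ⟨hw, hw.isSmoothIn hΩ, ?_, ?_⟩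
  · rw [eLpNorm_exponent_top]
    exact eLpNormEssSup_le_of_ae_bound
      (ae_restrict_of_ae (hbound.mono fun x hx => hx.trans (le_max_left _ _)))
  · rw [eLpNorm_exponent_top]
    exact eLpNormEssSup_le_of_ae_bound
      (Filter.Eventually.of_forall fun x => (hpot x).trans (le_max_right _ _))
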